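/- Throughout, C*-algebras are unital and $\otimes$ between C*-algebras is the minimal (spatial) tensor product. A compact quantum group (CQG) $(\mathcal A,\Delta)$ is a unital C*-algebra $\mathcal A$ with a unital $*$-homomorphism $\Delta:\mathcal A\to\mathcal A\otimes\mathcal A$ such that $(\Delta\otimes\mathrm{id})\Delta=(\mathrm{id}\otimes\Delta)\Delta$ and both $\operatorname{span}\Delta(\mathcal A)(1\otimes\mathcal A)$ and $\operatorname{span}\Delta(\mathcal A)(\mathcal A\otimes 1)$ are dense in $\mathcal A\otimes\mathcal A$. A co-action of $(\mathcal A,\Delta)$ on a unital C*-algebra $B$ is a unital $*$-homomorphism $\gamma:B\to B\otimes\mathcal A$ with $(\gamma\otimes\mathrm{id})\gamma=(\mathrm{id}\otimes\Delta)\gamma$ and $\operatorname{span}\gamma(B)(1\otimes\mathcal A)$ dense in $B\otimes\mathcal A$. Let $\Gamma=(V,E)$ be a finite directed multigraph with source and target maps $s,t:E\to V$ and without isolated vertices, i.e. $V=V^s\cup V^t$ where $V^s=s(E)$ and $V^t=t(E)$. Let $\chi_\tau$ ($\tau\in E$) and $\chi_i$ ($i\in V$) denote the indicator functions. For $f\in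 C(V^s)$ let $S(f)$ be multiplication by $f\circ s$ on $L^2(E)$, and for $f\in C(V^t)$ let $T(f)$ be multiplication by $f\circ t$. Let $\beta:L^2(E)\to L^2(E)\otimes\mathcal A$ be linear, $\beta(\chi_\tau)=\sum_{\sigma\in E}\chi_\sigma\otimes u^\sigma_\tau$, and put $U=(u^\sigma_\tau)$, $\overline U=(u^{\sigma *}_\tau)$ in $M_E(\mathcal A)=B(L^2(E))\otimes\mathcal A$. Suppose that $\beta$ is a co-action of $(\mathcal A,\Delta)$ on $\Gamma$ preserving its quantum symmetry in Banica's sense, that is: $\Delta(u^\sigma_\tau)=\sum_\rho u^\sigma_\rho\otimes u^\rho_\tau$ for all $\sigma,\tau$; $U$ and $\overline U$ are unitary; and, with $Ad_\beta(X)=U(X\otimes1)U^*$ and $Ad_{\overline\beta}(X)=\overline U(X\otimes1)\overline U^{\,*}$, 1. $Ad_\beta(S(C(V^s)))\subseteq S(C(V^s))\otimes\mathcal A$; 2. $Ad_{\overline\beta}(T(C(V^t)))\subseteq T(C(V^t))\otimes\mathcal A$; 3. the maps $\alpha_s:C(V^s)\to C(V^s)\otimes\mathcal A$ and $\alpha_t:C(V^t)\to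 C(V^t)\otimes\mathcal A$ determined by $Ad_\beta\circ S=(S\otimes\mathrm{id})\circ\alpha_s$ and $Ad_{\overline\beta}\circ T=(T\otimes\mathrm{id})\circ\alpha_t$ both map $C(V^s\cap V^t)$ into $C(V^s\cap V^t)\otimes\mathcal A$ and agree there; 4. $\beta(\xi_0)=\xi_0\otimes1$ for $\xi_0=\sum_{\tau\in E}\chi_\tau$. Let $\alpha:C(V)\to C(V)\otimes\mathcal A$ be the induced co-action, given by $\alpha(\chi_i)=\alpha_s(\chi_i)$ for $i\in V^s$ and $\alpha(\chi_i)=\alpha_t(\chi_i)$ for $i\in V^t$, and write $\alpha(\chi_i)=\sum_{k\in V}\chi_k\otimes q^k_i$. Let $C^*(\Gamma)$ be the graph C*-algebra: the universal C*-algebra generated by mutually orthogonal projections $p_i$ ($i\in V$) and partial isometries $s_\tau$ ($\tau\in E$) with $s_\tau^*s_\tau=p_{t(\tau)}$ for all $\tau\in E$ and $\sum_{\tau:\,s(\tau)=i}s_\tau s_\tau^*=p_i$ for all $i\in V^s$; its unit is $\sum_{i\in V}p_i$. **Theorem.** There is a co-action $\beta':C^*(\Gamma)\to C^*(\Gamma)\otimes\mathcal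 A$ of $(\mathcal A,\Delta)$ on $C^*(\Gamma)$ such that $$\beta'(p_i)=\sum_{k\in V}p_k\otimes q^k_i\quad(i\in V),\qquad \beta'(s_\tau)=\sum_{\sigma\in E}s_\sigma\otimes u^\sigma_\tau\quad(\tau\in E).$$ -/

import Mathlib

set_option linter.unusedSectionVars false

universe u

open scoped CStarAlgebra TensorProduct

noncomputable section

section ExtendDense

variable {T X Y : Type*} [Ring T] [StarRing T] [Algebra ℂ T] [CStarAlgebra X] [CStarAlgebra Y]

/-- The extension of a *-homomorphism `f` along a *-homomorphism `e` with dense range, when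
`‖f t‖ ≤ ‖e t‖` for all `t`. -/
def extendDense (e : T →⋆ₐ[ℂ] X) (he : DenseRange e) (f : T →⋆ₐ[ℂ] Y)
    (h : ∀ t, ‖f t‖ ≤ ‖e t‖) : X →⋆ₐ[ℂ] Y :=
  let F : X →L[ℂ] Y := (f : T →ₗ[ℂ] Y).extendOfNorm (e : T →ₗ[ℂ] X)
  have hF : ∀ t, F (e t) = f t := fun t =>
    LinearMap.extendOfNorm_eq (f := (f : T →ₗ[ℂ] Y)) (e := (e : T →ₗ[ℂ] X)) he
      ⟨1, fun t => (h t).trans_eq (one_mul _).symm⟩ t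
  have h1 : F 1 = 1 := by rw [← map_one e, hF, map_one]
  { toFun := F
    map_one' := h1
    map_zero' := map_zero F
    map_add' := map_add F
    map_mul' := fun x y => by
      refine he.induction_on₂ (p := fun x y => F (x * y) = F x * F y)
        (isClosed_eq (by fun_prop) (by fun_prop)) (fun s t => ?_) x y
      rw [← map_mul, hF, hF, hF, map_mul]
    commutes' := fun c => by
      change F (algebraMap ℂ X c) = _
      rw [Algebra.algebraMap_eq_smul_one, map_smul, h1, Algebra.algebraMap_eq_smul_one]
    map_star' := fun x => by
      refine he.induction_on (p := fun x => F (star x) = star (F x)) x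
        (isClosed_eq (by fun_prop) (by fun_prop)) (fun t => ?_)
      rw [← map_star, hF, hF, map_star] }

theorem extendDense_apply (e : T →⋆ₐ[ℂ] X) (he : DenseRange e) (f : T →⋆ₐ[ℂ] Y)
    (h : ∀ t, ‖f t‖ ≤ ‖e t‖) (t : T) : extendDense e he f h (e t) = f t :=
  LinearMap.extendOfNorm_eq (f := (f : T →ₗ[ℂ] Y)) (e := (e : T →ₗ[ℂ] X)) he
    ⟨1, fun t => (h t).trans_eq (one_mul _).symm⟩ t

end ExtendDense

/-- A C*-seminorm on a complex unital *-algebra. -/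
structure CStarSeminorm (R : Type*) [Ring R] [Algebra ℂ R] [StarRing R] extends Seminorm ℂ R where
  mul_le' : ∀ x y : R, toFun (x * y) ≤ toFun x * toFun y
  star_mul_self' : ∀ x : R, toFun (star x * x) = toFun x * toFun x

namespace CStarSeminorm

section Basic

variable {R : Type*} [Ring R] [Algebra ℂ R] [StarRing R]

instance : CoeFun (CStarSeminorm R) (fun _ => R → ℝ) := ⟨fun N => N.toSeminorm⟩

theorem mul_le (N : CStarSeminorm R) (x y : R) : N (x * y) ≤ N x * N y := N.mul_le' x y

theorem star_mul_self (N : CStarSeminorm R) (x : R) : N (star x * x) = N x * N x :=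
  N.star_mul_self' x

theorem nonneg (N : CStarSeminorm R) (x : R) : 0 ≤ N x := apply_nonneg N.toSeminorm x

theorem le_star (N : CStarSeminorm R) (x : R) : N x ≤ N (star x) := by
  by_contra! h
  have h1 := N.star_mul_self x
  have h2 := N.mul_le (star x) x
  have h3 := N.nonneg (star x)
  nlinarith

theorem apply_star (N : CStarSeminorm R) (x : R) : N (star x) = N x :=
  le_antisymm (by simpa using N.le_star (star x)) (N.le_star x)

/-- The pull-back of the norm of a C*-algebra along a *-homomorphism. -/
def ofStarAlgHom {D : Type*} [CStarAlgebra D] (φ : R →⋆ₐ[ℂ] D) : CStarSeminorm R where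
  toFun x := ‖φ x‖
  map_zero' := by simp
  add_le' x y := by simpa using norm_add_le (φ x) (φ y)
  neg' x := by simp
  smul' c x := by simp [norm_smul]
  mul_le' x y := by simpa using norm_mul_le (φ x) (φ y)
  star_mul_self' x := by
    rw [map_mul, map_star]; exact CStarRing.norm_star_mul_self

@[simp] theorem ofStarAlgHom_apply {D : Type*} [CStarAlgebra D] (φ : R →⋆ₐ[ℂ] D) (x : R) :
    ofStarAlgHom φ x = ‖φ x‖ := rfl

/-- The pointwise supremum of a nonempty pointwise bounded family of C*-seminorms. -/
def sup {ι : Sort*} [Nonempty ι] (N : ι → CStarSeminorm R)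
    (hN : ∀ x, BddAbove (Set.range fun i => N i x)) : CStarSeminorm R where
  toFun x := ⨆ i, N i x
  map_zero' := by simp
  add_le' x y := ciSup_le fun i => (map_add_le_add (N i).toSeminorm x y).trans
    (add_le_add (le_ciSup (hN x) i) (le_ciSup (hN y) i))
  neg' x := by simp
  smul' c x := by simp [map_smul_eq_mul, Real.mul_iSup_of_nonneg]
  mul_le' x y := ciSup_le fun i => ((N i).mul_le x y).trans
    (mul_le_mul (le_ciSup (hN x) i) (le_ciSup (hN y) i) ((N i).nonneg _)
      (Real.iSup_nonneg fun j => (N j).nonneg x))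
  star_mul_self' x := by
    have h0 : 0 ≤ ⨆ i, N i x := Real.iSup_nonneg fun j => (N j).nonneg x
    apply le_antisymm
    · exact ciSup_le fun i => ((N i).star_mul_self x).trans_le
        (mul_le_mul (le_ciSup (hN x) i) (le_ciSup (hN x) i) ((N i).nonneg _) h0)
    · have h1 : ∀ i, N i x ≤ Real.sqrt (⨆ i, N i (star x * x)) := fun i => by
        apply Real.le_sqrt_of_sq_le
        rw [pow_two, ← (N i).star_mul_self x]
        exact le_ciSup (hN (star x * x)) i
      have h2 := ciSup_le h1
      calc (⨆ i, N i x) * (⨆ i, N i x)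
          ≤ Real.sqrt (⨆ i, N i (star x * x)) * Real.sqrt (⨆ i, N i (star x * x)) :=
            mul_le_mul h2 h2 h0 (Real.sqrt_nonneg _)
        _ = _ := Real.mul_self_sqrt (Real.iSup_nonneg fun j => (N j).nonneg _)

theorem sup_apply {ι : Sort*} [Nonempty ι] (N : ι → CStarSeminorm R)
    (hN : ∀ x, BddAbove (Set.range fun i => N i x)) (x : R) : sup N hN x = ⨆ i, N i x := rfl

end Basic

/-- The algebra `R`, with the C*-seminorm `N` as its seminorm. -/
@[nolint unusedArguments]
def Carrier {R : Type u} [Ring R] [Algebra ℂ R] [StarRing R] (_N : CStarSeminorm R) : Type u := R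

section Completion


variable {R : Type u} [Ring R] [Algebra ℂ R] [StarRing R] (N : CStarSeminorm R)

instance : Ring N.Carrier := inferInstanceAs (Ring R)
instance : Algebra ℂ N.Carrier := inferInstanceAs (Algebra ℂ R)
instance : StarRing N.Carrier := inferInstanceAs (StarRing R)
instance [StarModule ℂ R] : StarModule ℂ N.Carrier := inferInstanceAs (StarModule ℂ R)

/-- The identity map from `R` to its seminormed copy. -/
def toCarrier : R ≃⋆ₐ[ℂ] N.Carrier := StarAlgEquiv.refl ℂ R

instance : SeminormedRing N.Carrier :=
  { (inferInstance : Ring N.Carrier),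
    AddGroupSeminorm.toSeminormedAddCommGroup (E := N.Carrier) N.toSeminorm.toAddGroupSeminorm with
    norm_mul_le := N.mul_le }

theorem norm_toCarrier (x : R) : ‖N.toCarrier x‖ = N x := rfl

instance : NormedAlgebra ℂ N.Carrier where
  norm_smul_le c x := (map_smul_eq_mul N.toSeminorm c (x : R)).le

instance : NormedStarGroup N.Carrier where
  norm_star_le x := (N.apply_star x).le

/-- The C*-algebra obtained from `R` by dividing out the null space of `N` and completing. -/
def Completed : Type u := UniformSpace.Completion N.Carrier

instance : NormedRing N.Completed :=
  inferInstanceAs (NormedRing (UniformSpace.Completion N.Carrier))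

instance : NormedAlgebra ℂ N.Completed where
  __ : Algebra ℂ N.Completed := inferInstanceAs (Algebra ℂ (UniformSpace.Completion N.Carrier))
  norm_smul_le := norm_smul_le (α := ℂ) (β := UniformSpace.Completion N.Carrier)

instance : CompleteSpace N.Completed :=
  inferInstanceAs (CompleteSpace (UniformSpace.Completion N.Carrier))

/-- The canonical homomorphism from `R` to the completion. -/
def coeAlgHom : R →ₐ[ℂ] N.Completed where
  toFun x := ((N.toCarrier x : N.Carrier) : UniformSpace.Completion N.Carrier)
  map_one' := UniformSpace.Completion.coe_one _
  map_zero' := UniformSpace.Completion.coe_zero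
  map_mul' x y := UniformSpace.Completion.coe_mul (N.toCarrier x) (N.toCarrier y)
  map_add' x y := UniformSpace.Completion.coe_add (N.toCarrier x) (N.toCarrier y)
  commutes' _ := rfl

theorem norm_coeAlgHom (x : R) : ‖N.coeAlgHom x‖ = N x :=
  UniformSpace.Completion.norm_coe (N.toCarrier x)

theorem denseRange_coeAlgHom : DenseRange N.coeAlgHom :=
  UniformSpace.Completion.denseRange_coe (α := N.Carrier)

instance : Star N.Completed where
  star := UniformSpace.Completion.map (star : N.Carrier → N.Carrier)

theorem star_coeAlgHom (x : R) : star (N.coeAlgHom x) = N.coeAlgHom (star x) :=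
  UniformSpace.Completion.map_coe
    (uniformContinuous_addMonoidHom_of_continuous
      (f := (starAddEquiv : N.Carrier ≃+ N.Carrier).toAddMonoidHom) continuous_star) (N.toCarrier x)

theorem continuous_star_completed : Continuous (star : N.Completed → N.Completed) :=
  UniformSpace.Completion.continuous_map

variable [StarModule ℂ R]

instance : CStarAlgebra N.Completed where
  star_involutive x := by
    refine N.denseRange_coeAlgHom.induction_on x (isClosed_eq (by
      exact N.continuous_star_completed.comp N.continuous_star_completed) continuous_id) ?_
    intro x; simp [star_coeAlgHom]
  star_mul x y := by
    refine N.denseRange_coeAlgHom.induction_on₂ (p := fun x y => star (x * y) = star y * star x)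
      (isClosed_eq (N.continuous_star_completed.comp continuous_mul)
        ((N.continuous_star_completed.comp continuous_snd).mul
          (N.continuous_star_completed.comp continuous_fst))) ?_ x y
    intro x y; simp only [star_coeAlgHom, ← map_mul, star_mul]
  star_add x y := by
    refine N.denseRange_coeAlgHom.induction_on₂ (p := fun x y => star (x + y) = star x + star y)
      (isClosed_eq (N.continuous_star_completed.comp continuous_add)
        ((N.continuous_star_completed.comp continuous_fst).add
          (N.continuous_star_completed.comp continuous_snd))) ?_ x y
    intro x y; simp only [star_coeAlgHom, ← map_add, star_add]
  norm_mul_self_le x := by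
    refine N.denseRange_coeAlgHom.induction_on (p := fun x => ‖x‖ * ‖x‖ ≤ ‖star x * x‖) x
      (isClosed_le (by fun_prop) (N.continuous_star_completed.mul continuous_id).norm) ?_
    intro x
    rw [star_coeAlgHom, ← map_mul, norm_coeAlgHom, norm_coeAlgHom, N.star_mul_self]
  star_smul c x := by
    refine N.denseRange_coeAlgHom.induction_on (p := fun x => star (c • x) = star c • star x) x
      (isClosed_eq (N.continuous_star_completed.comp (continuous_const_smul c))
        ((continuous_const_smul (star c)).comp N.continuous_star_completed)) ?_
    intro x
    rw [star_coeAlgHom, ← map_smul, star_coeAlgHom, star_smul, map_smul]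

/-- The canonical *-homomorphism from `R` to its completion. -/
def coeHom : R →⋆ₐ[ℂ] N.Completed where
  __ := N.coeAlgHom
  map_star' x := (N.star_coeAlgHom x).symm

theorem norm_coeHom (x : R) : ‖N.coeHom x‖ = N x := N.norm_coeAlgHom x

theorem denseRange_coeHom : DenseRange N.coeHom := N.denseRange_coeAlgHom

variable {D : Type*} [CStarAlgebra D]

/-- A *-homomorphism that is contractive for `N` extends to the completion. -/
def lift (φ : R →⋆ₐ[ℂ] D) (hφ : ∀ x, ‖φ x‖ ≤ N x) : N.Completed →⋆ₐ[ℂ] D :=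
  extendDense N.coeHom N.denseRange_coeHom φ fun x => (hφ x).trans_eq (N.norm_coeHom x).symm

@[simp] theorem lift_coeHom (φ : R →⋆ₐ[ℂ] D) (hφ : ∀ x, ‖φ x‖ ≤ N x) (x : R) :
    N.lift φ hφ (N.coeHom x) = φ x :=
  extendDense_apply _ _ _ _ x

/-- *-homomorphisms on the completion are determined by their values on `R`. -/
theorem hom_ext {φ ψ : N.Completed →⋆ₐ[ℂ] D} (h : ∀ x, φ (N.coeHom x) = ψ (N.coeHom x)) :
    φ = ψ := by
  ext x
  refine N.denseRange_coeHom.induction_on (p := fun x => φ x = ψ x) x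
    (isClosed_eq (map_continuous φ) (map_continuous ψ)) h

end Completion
end CStarSeminorm

/-! ### Hilbert space tensor products -/

section HilbertTensor

variable (H K : Type u) [NormedAddCommGroup H] [InnerProductSpace ℂ H]
  [NormedAddCommGroup K] [InnerProductSpace ℂ K]

/-- The Hilbert space tensor product: the completion of the algebraic tensor product for the inner
product `⟪x ⊗ y, x' ⊗ y'⟫ = ⟪x, x'⟫ ⟪y, y'⟫`. -/
def HilbertTensor : Type u := UniformSpace.Completion (H ⊗[ℂ] K)

namespace HilbertTensor

instance : NormedAddCommGroup (HilbertTensor H K) :=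
  inferInstanceAs (NormedAddCommGroup (UniformSpace.Completion (H ⊗[ℂ] K)))

instance : InnerProductSpace ℂ (HilbertTensor H K) :=
  inferInstanceAs (InnerProductSpace ℂ (UniformSpace.Completion (H ⊗[ℂ] K)))

instance : CompleteSpace (HilbertTensor H K) :=
  inferInstanceAs (CompleteSpace (UniformSpace.Completion (H ⊗[ℂ] K)))

variable {H K}

/-- The canonical isometric embedding of the algebraic tensor product. -/
def of : H ⊗[ℂ] K →ₗᵢ[ℂ] HilbertTensor H K := UniformSpace.Completion.toComplₗᵢ (𝕜 := ℂ)

theorem denseRange_of : DenseRange (of : H ⊗[ℂ] K → HilbertTensor H K) :=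
  UniformSpace.Completion.denseRange_coe

/-- The bounded operator `S ⊗ T` on the Hilbert space tensor product. -/
def map (S : H →L[ℂ] H) (T : K →L[ℂ] K) : HilbertTensor H K →L[ℂ] HilbertTensor H K :=
  (TensorProduct.mapL S T).completion

theorem map_of (S : H →L[ℂ] H) (T : K →L[ℂ] K) (ξ : H ⊗[ℂ] K) :
    map S T (of ξ) = of (TensorProduct.map (S : H →ₗ[ℂ] H) (T : K →ₗ[ℂ] K) ξ) :=
  by
  have h : map S T (of ξ) = of (TensorProduct.mapL S T ξ) :=
    (TensorProduct.mapL S T).completion_apply_coe ξ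
  rw [h, ← TensorProduct.toLinearMap_mapL]; rfl

theorem map_tmul (S : H →L[ℂ] H) (T : K →L[ℂ] K) (x : H) (y : K) :
    map S T (of (x ⊗ₜ[ℂ] y)) = of (S x ⊗ₜ[ℂ] T y) := map_of S T _

theorem op_ext {S T : HilbertTensor H K →L[ℂ] HilbertTensor H K}
    (h : ∀ x y, S (of (x ⊗ₜ[ℂ] y)) = T (of (x ⊗ₜ[ℂ] y))) : S = T := by
  ext ξ
  refine denseRange_of.induction_on (p := fun ξ => S ξ = T ξ) ξ
    (isClosed_eq S.continuous T.continuous) fun ξ => ?_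
  induction ξ using TensorProduct.induction_on with
  | zero => simp
  | tmul x y => exact h x y
  | add x y hx hy => rw [map_add, map_add, map_add, hx, hy]

theorem star_map [CompleteSpace H] [CompleteSpace K] (S : H →L[ℂ] H) (T : K →L[ℂ] K) :
    star (map S T) = map (star S) (star T) := by
  rw [ContinuousLinearMap.star_eq_adjoint, eq_comm, ContinuousLinearMap.eq_adjoint_iff]
  intro ξ η
  refine denseRange_of.induction_on₂
    (p := fun ξ η => inner ℂ (map (star S) (star T) ξ) η = inner ℂ ξ (map S T η))
    (by apply isClosed_eq <;> fun_prop) (fun ξ η => ?_) ξ η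
  rw [map_of, map_of, LinearIsometry.inner_map_map, LinearIsometry.inner_map_map]
  induction ξ using TensorProduct.induction_on with
  | zero => simp
  | add x y hx hy => simp only [map_add, inner_add_left, hx, hy]
  | tmul x y =>
    induction η using TensorProduct.induction_on with
    | zero => simp
    | add x y hx hy => simp only [map_add, inner_add_right, hx, hy]
    | tmul x' y' =>
      simp [ContinuousLinearMap.star_eq_adjoint, ContinuousLinearMap.adjoint_inner_left]

end HilbertTensor

end HilbertTensor

/-! ### The minimal tensor product -/

/-- A unital *-representation of a C*-algebra on a Hilbert space. -/
structure HilbertRep (A : Type u) [CStarAlgebra A] where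
  /-- the Hilbert space -/
  space : Type u
  [normedAddCommGroup : NormedAddCommGroup space]
  [innerProductSpace : InnerProductSpace ℂ space]
  [completeSpace : CompleteSpace space]
  /-- the *-homomorphism into the bounded operators -/
  toHom : A →⋆ₐ[ℂ] (space →L[ℂ] space)

namespace HilbertRep

attribute [instance] normedAddCommGroup innerProductSpace completeSpace

variable {A B : Type u} [CStarAlgebra A] [CStarAlgebra B]

/-- The zero representation, on the zero Hilbert space. -/
instance : Inhabited (HilbertRep A) := ⟨{
  space := PUnit.{u+1}
  toHom :=
    { toFun := fun _ => 0
      map_one' := Subsingleton.elim _ _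
      map_mul' := fun _ _ => Subsingleton.elim _ _
      map_zero' := Subsingleton.elim _ _
      map_add' := fun _ _ => Subsingleton.elim _ _
      commutes' := fun _ => Subsingleton.elim _ _
      map_star' := fun _ => Subsingleton.elim _ _ } }⟩

/-- The restriction of a representation along a *-homomorphism. -/
def comap (f : A →⋆ₐ[ℂ] B) (π : HilbertRep B) : HilbertRep A where
  space := π.space
  toHom := π.toHom.comp f

/-- The Hilbert space tensor product of the spaces of two representations. -/
abbrev tensorSpace (π : HilbertRep A) (ρ : HilbertRep B) : Type u :=
  HilbertTensor π.space ρ.space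

/-- The representation `a ↦ π(a) ⊗ 1`. -/
def leftHom (π : HilbertRep A) (ρ : HilbertRep B) :
    A →⋆ₐ[ℂ] (tensorSpace π ρ →L[ℂ] tensorSpace π ρ) where
  toFun a := HilbertTensor.map (π.toHom a) 1
  map_one' := HilbertTensor.op_ext fun x y => by simp [HilbertTensor.map_tmul]
  map_mul' a b := HilbertTensor.op_ext fun x y => by simp [HilbertTensor.map_tmul]
  map_zero' := HilbertTensor.op_ext fun x y => by simp [HilbertTensor.map_tmul]
  map_add' a b := HilbertTensor.op_ext fun x y => by
    simp [HilbertTensor.map_tmul, TensorProduct.add_tmul]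
  commutes' c := HilbertTensor.op_ext fun x y => by
    simp [HilbertTensor.map_tmul, Algebra.algebraMap_eq_smul_one, ← TensorProduct.smul_tmul']
  map_star' a := by rw [HilbertTensor.star_map, map_star, star_one]

/-- The representation `b ↦ 1 ⊗ ρ(b)`. -/
def rightHom (π : HilbertRep A) (ρ : HilbertRep B) :
    B →⋆ₐ[ℂ] (tensorSpace π ρ →L[ℂ] tensorSpace π ρ) where
  toFun b := HilbertTensor.map 1 (ρ.toHom b)
  map_one' := HilbertTensor.op_ext fun x y => by simp [HilbertTensor.map_tmul]
  map_mul' a b := HilbertTensor.op_ext fun x y => by simp [HilbertTensor.map_tmul]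
  map_zero' := HilbertTensor.op_ext fun x y => by simp [HilbertTensor.map_tmul]
  map_add' a b := HilbertTensor.op_ext fun x y => by
    simp [HilbertTensor.map_tmul, TensorProduct.tmul_add]
  commutes' c := HilbertTensor.op_ext fun x y => by
    simp [HilbertTensor.map_tmul, Algebra.algebraMap_eq_smul_one]
  map_star' a := by rw [HilbertTensor.star_map, map_star, star_one]

/-- The homomorphism `a ⊗ b ↦ π(a) ⊗ ρ(b)` on the algebraic tensor product. -/
def tensorAlgHom (π : HilbertRep A) (ρ : HilbertRep B) :
    A ⊗[ℂ] B →ₐ[ℂ] (tensorSpace π ρ →L[ℂ] tensorSpace π ρ) :=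
  Algebra.TensorProduct.lift (leftHom π ρ).toAlgHom (rightHom π ρ).toAlgHom fun a b =>
    HilbertTensor.op_ext fun x y => by simp [HilbertTensor.map_tmul, leftHom, rightHom]

theorem tensorAlgHom_tmul (π : HilbertRep A) (ρ : HilbertRep B) (a : A) (b : B) :
    tensorAlgHom π ρ (a ⊗ₜ[ℂ] b) = leftHom π ρ a * rightHom π ρ b :=
  Algebra.TensorProduct.lift_tmul ..

theorem leftHom_mul_rightHom (π : HilbertRep A) (ρ : HilbertRep B) (a : A) (b : B) :
    leftHom π ρ a * rightHom π ρ b = HilbertTensor.map (π.toHom a) (ρ.toHom b) :=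
  HilbertTensor.op_ext fun x y => by simp [HilbertTensor.map_tmul, leftHom, rightHom]

/-- The representation `π ⊗ ρ` of the algebraic tensor product on the Hilbert space tensor
product. -/
def tensor (π : HilbertRep A) (ρ : HilbertRep B) :
    A ⊗[ℂ] B →⋆ₐ[ℂ] (tensorSpace π ρ →L[ℂ] tensorSpace π ρ) where
  __ := tensorAlgHom π ρ
  map_star' x := by
    change tensorAlgHom π ρ (star x) = star (tensorAlgHom π ρ x)
    induction x using TensorProduct.induction_on with
    | zero => rw [star_zero, map_zero, star_zero]
    | add x y hx hy => rw [star_add, map_add, map_add, star_add, hx, hy]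
    | tmul a b =>
      rw [TensorProduct.star_tmul, tensorAlgHom_tmul, tensorAlgHom_tmul, leftHom_mul_rightHom,
        leftHom_mul_rightHom, HilbertTensor.star_map, map_star, map_star]

theorem tensor_tmul (π : HilbertRep A) (ρ : HilbertRep B) (a : A) (b : B) :
    tensor π ρ (a ⊗ₜ[ℂ] b) = HilbertTensor.map (π.toHom a) (ρ.toHom b) :=
  (tensorAlgHom_tmul π ρ a b).trans (leftHom_mul_rightHom π ρ a b)

/-- The cross-norm estimate `‖π(a) ⊗ ρ(b)‖ ≤ ‖a‖ ‖b‖`. -/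
theorem norm_tensor_tmul_le (π : HilbertRep A) (ρ : HilbertRep B) (a : A) (b : B) :
    ‖tensor π ρ (a ⊗ₜ[ℂ] b)‖ ≤ ‖a‖ * ‖b‖ := by
  rw [tensor_tmul, ← leftHom_mul_rightHom]
  exact (norm_mul_le _ _).trans (mul_le_mul (NonUnitalStarAlgHom.norm_apply_le (leftHom π ρ) a)
    (NonUnitalStarAlgHom.norm_apply_le (rightHom π ρ) b) (norm_nonneg _) (norm_nonneg _))

theorem bddAbove_norm_tensor (x : A ⊗[ℂ] B) : BddAbove (Set.range
    fun p : HilbertRep A × HilbertRep B => CStarSeminorm.ofStarAlgHom (p.1.tensor p.2) x) := by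
  induction x using TensorProduct.induction_on with
  | zero => exact ⟨0, by rintro _ ⟨p, rfl⟩; simp⟩
  | tmul a b => exact ⟨‖a‖ * ‖b‖, by rintro _ ⟨p, rfl⟩; exact norm_tensor_tmul_le p.1 p.2 a b⟩
  | add x y hx hy =>
    obtain ⟨c, hc⟩ := hx
    obtain ⟨d, hd⟩ := hy
    refine ⟨c + d, ?_⟩
    rintro _ ⟨p, rfl⟩
    exact (map_add_le_add (CStarSeminorm.ofStarAlgHom (p.1.tensor p.2)).toSeminorm x y).trans
      (add_le_add (hc ⟨p, rfl⟩) (hd ⟨p, rfl⟩))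

end HilbertRep

section MinTensor

section Algebraic

variable {A B A' B' : Type*} [Ring A] [Algebra ℂ A] [StarRing A] [StarModule ℂ A]
  [Ring B] [Algebra ℂ B] [StarRing B] [StarModule ℂ B]
  [Ring A'] [Algebra ℂ A'] [StarRing A'] [StarModule ℂ A']
  [Ring B'] [Algebra ℂ B'] [StarRing B'] [StarModule ℂ B']

/-- The tensor product of two *-homomorphisms on the algebraic tensor products. -/
def tensorMapAlg (f : A →⋆ₐ[ℂ] A') (g : B →⋆ₐ[ℂ] B') : A ⊗[ℂ] B →⋆ₐ[ℂ] A' ⊗[ℂ] B' where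
  __ := Algebra.TensorProduct.map f.toAlgHom g.toAlgHom
  map_star' x := by
    change Algebra.TensorProduct.map f.toAlgHom g.toAlgHom (star x) =
      star (Algebra.TensorProduct.map f.toAlgHom g.toAlgHom x)
    induction x using TensorProduct.induction_on with
    | zero => simp
    | tmul a b => simp [map_star]
    | add x y hx hy => rw [star_add, map_add, map_add, star_add, hx, hy]

@[simp] theorem tensorMapAlg_tmul (f : A →⋆ₐ[ℂ] A') (g : B →⋆ₐ[ℂ] B') (a : A) (b : B) :
    tensorMapAlg f g (a ⊗ₜ[ℂ] b) = f a ⊗ₜ[ℂ] g b := rfl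

end Algebraic

/-- The minimal (spatial) C*-norm on the algebraic tensor product: the supremum of the operator
norms of `(π ⊗ ρ)(x)` over all representations `π` of `A` and `ρ` of `B` on Hilbert spaces. -/
def minTensorNorm (A B : Type u) [CStarAlgebra A] [CStarAlgebra B] : CStarSeminorm (A ⊗[ℂ] B) :=
  CStarSeminorm.sup
    (fun p : HilbertRep A × HilbertRep B => CStarSeminorm.ofStarAlgHom (p.1.tensor p.2))
    HilbertRep.bddAbove_norm_tensor

/-- The minimal tensor product of two C*-algebras. -/
def MinTensor (A B : Type u) [CStarAlgebra A] [CStarAlgebra B] : Type u :=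
  (minTensorNorm A B).Completed

namespace MinTensor

variable {A B A' B' : Type u} [CStarAlgebra A] [CStarAlgebra B] [CStarAlgebra A'] [CStarAlgebra B']

instance : CStarAlgebra (MinTensor A B) :=
  inferInstanceAs (CStarAlgebra (minTensorNorm A B).Completed)

/-- The canonical map of the algebraic tensor product into the minimal tensor product. -/
def ofAlg : A ⊗[ℂ] B →⋆ₐ[ℂ] MinTensor A B := (minTensorNorm A B).coeHom

/-- The elementary tensor `a ⊗ b` in the minimal tensor product. -/
def tmul (a : A) (b : B) : MinTensor A B := ofAlg (a ⊗ₜ[ℂ] b)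

theorem norm_ofAlg (x : A ⊗[ℂ] B) : ‖(ofAlg x : MinTensor A B)‖ = minTensorNorm A B x :=
  CStarSeminorm.norm_coeHom _ x

theorem norm_tensor_le (π : HilbertRep A) (ρ : HilbertRep B) (x : A ⊗[ℂ] B) :
    ‖π.tensor ρ x‖ ≤ minTensorNorm A B x :=
  le_ciSup (HilbertRep.bddAbove_norm_tensor x) (π, ρ)

theorem minTensorNorm_le {x : A ⊗[ℂ] B} {c : ℝ}
    (h : ∀ (π : HilbertRep A) (ρ : HilbertRep B), ‖π.tensor ρ x‖ ≤ c) : minTensorNorm A B x ≤ c :=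
  ciSup_le fun p => h p.1 p.2

theorem denseRange_ofAlg : DenseRange (ofAlg : A ⊗[ℂ] B → MinTensor A B) :=
  CStarSeminorm.denseRange_coeHom _

/-- A *-homomorphism on the algebraic tensor product that is contractive for the minimal norm
extends to the minimal tensor product. -/
def lift {D : Type*} [CStarAlgebra D] (φ : A ⊗[ℂ] B →⋆ₐ[ℂ] D)
    (hφ : ∀ x, ‖φ x‖ ≤ minTensorNorm A B x) : MinTensor A B →⋆ₐ[ℂ] D :=
  (minTensorNorm A B).lift φ hφ

theorem lift_ofAlg {D : Type*} [CStarAlgebra D] (φ : A ⊗[ℂ] B →⋆ₐ[ℂ] D)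
    (hφ : ∀ x, ‖φ x‖ ≤ minTensorNorm A B x) (x : A ⊗[ℂ] B) : lift φ hφ (ofAlg x) = φ x :=
  (minTensorNorm A B).lift_coeHom φ hφ x

theorem hom_ext {D : Type*} [CStarAlgebra D] {φ ψ : MinTensor A B →⋆ₐ[ℂ] D}
    (h : ∀ a b, φ (tmul a b) = ψ (tmul a b)) : φ = ψ :=
  (minTensorNorm A B).hom_ext fun x => by
    change φ (ofAlg x) = ψ (ofAlg x)
    induction x using TensorProduct.induction_on with
    | zero => rw [map_zero, map_zero, map_zero]
    | tmul a b => exact h a b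
    | add x y hx hy => rw [map_add, map_add, map_add, hx, hy]

theorem tensor_mapAlg (f : A →⋆ₐ[ℂ] A') (g : B →⋆ₐ[ℂ] B') (π : HilbertRep A')
    (ρ : HilbertRep B') (x : A ⊗[ℂ] B) :
    π.tensor ρ (tensorMapAlg f g x) = (π.comap f).tensor (ρ.comap g) x := by
  induction x using TensorProduct.induction_on with
  | zero => rw [map_zero, map_zero, map_zero]; rfl
  | tmul a b => rw [tensorMapAlg_tmul, HilbertRep.tensor_tmul, HilbertRep.tensor_tmul]; rfl
  | add x y hx hy => rw [map_add, map_add, map_add, hx, hy]; rfl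

/-- The tensor product `f ⊗ g` of two *-homomorphisms, on the minimal tensor products. -/
def map (f : A →⋆ₐ[ℂ] A') (g : B →⋆ₐ[ℂ] B') : MinTensor A B →⋆ₐ[ℂ] MinTensor A' B' :=
  lift (ofAlg.comp (tensorMapAlg f g)) fun x => by
    rw [StarAlgHom.comp_apply, norm_ofAlg]
    refine minTensorNorm_le fun π ρ => ?_
    rw [tensor_mapAlg]
    exact norm_tensor_le _ _ x

theorem map_tmul (f : A →⋆ₐ[ℂ] A') (g : B →⋆ₐ[ℂ] B') (a : A) (b : B) :
    map f g (tmul a b) = tmul (f a) (g b) := by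
  rw [map, tmul, lift_ofAlg, StarAlgHom.comp_apply, tensorMapAlg_tmul, tmul]

end MinTensor
end MinTensor

/-! ### Independence of the minimal norm of the choice of faithful representations, and the
associativity of the minimal tensor product -/

namespace HilbertRep

section Matrix

variable {D : Type u} [CStarAlgebra D] {ι : Type} [Fintype ι]

/-- The action of a matrix over `D` on tuples of vectors of a representation of `D`. -/
def act (σ : HilbertRep D) (X : CStarMatrix ι ι D) (h : ι → σ.space) : ι → σ.space :=
  fun j => ∑ k, σ.toHom (X j k) (h k)

theorem act_mul (σ : HilbertRep D) (X Y : CStarMatrix ι ι D) (h : ι → σ.space) :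
    σ.act (X * Y) h = σ.act X (σ.act Y h) := by
  funext j
  simp only [act, CStarMatrix.mul_apply, map_sum, map_mul, sum_apply,
    mul_apply_eq_comp]
  exact Finset.sum_comm

theorem sum_inner_act_star (σ : HilbertRep D) (X : CStarMatrix ι ι D) (g h : ι → σ.space) :
    ∑ j, inner ℂ (g j) (σ.act (star X) h j) = ∑ j, inner ℂ (σ.act X g j) (h j) := by
  simp only [act, CStarMatrix.star_apply, map_star, inner_sum, sum_inner,
    ContinuousLinearMap.star_eq_adjoint, ContinuousLinearMap.adjoint_inner_right]
  exact Finset.sum_comm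

/-- The negative part of a selfadjoint element. -/
theorem exists_negPart {M : Type*} [CStarAlgebra M] (Z : M) (hZ : IsSelfAdjoint Z) :
    ∃ a s : M, star a = a ∧ a = star s * s ∧ Z * a = -(a * a) ∧
      (a = 0 → ∃ Y : M, Z = star Y * Y) := by
  let _ := CStarAlgebra.spectralOrder M
  have _ := CStarAlgebra.spectralOrderedRing M
  have ha : 0 ≤ Z⁻ := CFC.negPart_nonneg Z
  obtain ⟨s, hs⟩ := CStarAlgebra.nonneg_iff_eq_star_mul_self.mp ha
  refine ⟨Z⁻, s, ha.isSelfAdjoint, hs, ?_, fun h0 => ?_⟩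
  · nth_rewrite 1 [← CFC.posPart_sub_negPart Z hZ]
    rw [sub_mul, CFC.posPart_mul_negPart, zero_sub]
  · exact CStarAlgebra.nonneg_iff_eq_star_mul_self.mp ((CFC.negPart_eq_zero_iff Z hZ).mp h0)

/-- A selfadjoint matrix over `D` that acts positively in a faithful family of representations is
of the form `Y* Y`. -/
theorem exists_eq_star_mul_self [DecidableEq ι] [PartialOrder D] [StarOrderedRing D]
    (F : Set (HilbertRep D))
    (hF : ∀ d : D, (∀ σ ∈ F, σ.toHom d = 0) → d = 0) (Z : CStarMatrix ι ι D)
    (hZ : IsSelfAdjoint Z)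
    (hpos : ∀ σ ∈ F, ∀ h : ι → σ.space, 0 ≤ (∑ j, inner ℂ (h j) (σ.act Z h j)).re) :
    ∃ Y : CStarMatrix ι ι D, Z = star Y * Y := by
  obtain ⟨a, s, has, hs, hZa, ha0⟩ := exists_negPart Z hZ
  have h1 : star a * Z * a = -(star (s * a) * (s * a)) := by
    rw [mul_assoc, hZa, star_mul, has, mul_neg]
    nth_rewrite 2 [hs]
    simp only [mul_assoc]
  have h3 : s * a = 0 := by
    ext j k
    refine hF _ fun σ hσ => ?_
    have h4 : ∀ h : ι → σ.space, ∀ j, σ.act (s * a) h j = 0 := by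
      intro h
      have h5 := hpos σ hσ (σ.act a h)
      rw [← sum_inner_act_star, ← act_mul, ← act_mul, h1] at h5
      have h6 : ∑ j, inner ℂ (h j) (σ.act (-(star (s * a) * (s * a))) h j) =
          -∑ j, inner ℂ (σ.act (s * a) h j) (σ.act (s * a) h j) := by
        rw [← sum_inner_act_star, ← act_mul, ← Finset.sum_neg_distrib]
        refine Finset.sum_congr rfl fun j _ => ?_
        rw [← inner_neg_right]
        congr 1
        simp [act]
      rw [h6] at h5
      simp only [inner_self_eq_norm_sq_to_K, Complex.neg_re, Complex.re_sum] at h5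
      have h7 : ∑ j, ‖σ.act (s * a) h j‖ ^ 2 ≤ 0 := by
        have : ∀ j, ((‖σ.act (s * a) h j‖ : ℂ) ^ 2).re = ‖σ.act (s * a) h j‖ ^ 2 := fun j => by
          rw [← Complex.ofReal_pow, Complex.ofReal_re]
        simp only [Complex.coe_algebraMap, this] at h5
        linarith
      intro j
      have h8 := (Finset.sum_eq_zero_iff_of_nonneg (fun j _ => sq_nonneg _)).mp
        (le_antisymm h7 (Finset.sum_nonneg fun j _ => sq_nonneg _)) j (Finset.mem_univ j)
      exact norm_eq_zero.mp (pow_eq_zero_iff two_ne_zero |>.mp h8)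
    ext v
    have h9 := h4 (Pi.single k v) j
    rw [act, Finset.sum_eq_single k] at h9
    · simpa using h9
    · intro b _ hb; simp [Pi.single_eq_of_ne hb]
    · simp
  refine ha0 ?_
  have : star a * a = 0 := by
    nth_rewrite 1 [has, hs]
    rw [mul_assoc, h3, mul_zero]
  exact CStarRing.star_mul_self_eq_zero_iff _ |>.mp this

end Matrix

section Faithful

variable {A D : Type u} [CStarAlgebra A] [CStarAlgebra D]

/-- The slice map `a ⊗ d ↦ ⟪k, π(a) k'⟫ d`. -/
def slice (π : HilbertRep A) (k k' : π.space) : A ⊗[ℂ] D →ₗ[ℂ] D :=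
  TensorProduct.lift
    { toFun := fun a => (inner ℂ k (π.toHom a k') : ℂ) • (LinearMap.id : D →ₗ[ℂ] D)
      map_add' := fun a b => by simp [add_smul]
      map_smul' := fun c a => by simp [mul_smul] }

theorem slice_tmul (π : HilbertRep A) (k k' : π.space) (a : A) (d : D) :
    slice π k k' (a ⊗ₜ[ℂ] d) = (inner ℂ k (π.toHom a k') : ℂ) • d := rfl

theorem star_slice (π : HilbertRep A) (k k' : π.space) (y : A ⊗[ℂ] D) :
    star (slice π k k' y) = slice π k' k (star y) := by
  induction y using TensorProduct.induction_on with
  | zero => simp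
  | add x y hx hy => rw [star_add, map_add, map_add, star_add, hx, hy]
  | tmul a d =>
    rw [TensorProduct.star_tmul, slice_tmul, slice_tmul, star_smul, map_star,
      ContinuousLinearMap.star_eq_adjoint, ContinuousLinearMap.adjoint_inner_right]
    congr 1
    exact inner_conj_symm _ _

theorem inner_tensor (π : HilbertRep A) (σ : HilbertRep D) (k k' : π.space) (g g' : σ.space)
    (y : A ⊗[ℂ] D) :
    inner ℂ (HilbertTensor.of (k ⊗ₜ[ℂ] g)) (π.tensor σ y (HilbertTensor.of (k' ⊗ₜ[ℂ] g'))) =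
      inner ℂ g (σ.toHom (slice π k k' y) g') := by
  induction y using TensorProduct.induction_on with
  | zero => simp
  | add x y hx hy =>
    simp only [map_add, add_apply, inner_add_right, hx, hy]
  | tmul a d =>
    rw [tensor_tmul, HilbertTensor.map_tmul, LinearIsometry.inner_map_map,
      TensorProduct.inner_tmul, slice_tmul, map_smul, smul_apply,
      inner_smul_right]

/-- The matrix of slices of `y`. -/
def sliceMatrix (π : HilbertRep A) {ι : Type} (k : ι → π.space) (y : A ⊗[ℂ] D) :
    CStarMatrix ι ι D := CStarMatrix.ofMatrix (Matrix.of fun i j => slice π (k i) (k j) y)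

theorem sliceMatrix_apply (π : HilbertRep A) {ι : Type} (k : ι → π.space) (y : A ⊗[ℂ] D)
    (i j : ι) : sliceMatrix π k y i j = slice π (k i) (k j) y := rfl

theorem inner_tensor_sum (π : HilbertRep A) (σ : HilbertRep D) {ι : Type} [Fintype ι]
    (k : ι → π.space) (g : ι → σ.space) (y : A ⊗[ℂ] D) :
    inner ℂ (HilbertTensor.of (∑ j, k j ⊗ₜ[ℂ] g j))
      (π.tensor σ y (HilbertTensor.of (∑ j, k j ⊗ₜ[ℂ] g j))) =
      ∑ j, inner ℂ (g j) (σ.act (sliceMatrix π k y) g j) := by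
  simp only [map_sum, sum_inner, inner_sum, inner_tensor, act, sliceMatrix_apply]
  exact Finset.sum_comm

theorem re_inner_sub (π : HilbertRep A) (σ : HilbertRep D) (x : A ⊗[ℂ] D) (c : ℝ)
    (ζ : tensorSpace π σ) :
    (inner ℂ ζ (π.tensor σ (((c ^ 2 : ℝ) : ℂ) • (1 : A ⊗[ℂ] D) - star x * x) ζ)).re =
      c ^ 2 * ‖ζ‖ ^ 2 - ‖π.tensor σ x ζ‖ ^ 2 := by
  rw [map_sub, map_smul, map_one, map_mul, map_star, sub_apply, smul_apply, one_apply_eq_self,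
    mul_apply_eq_comp, inner_sub_right, inner_smul_right, ContinuousLinearMap.star_eq_adjoint,
    ContinuousLinearMap.adjoint_inner_right, inner_self_eq_norm_sq_to_K,
    inner_self_eq_norm_sq_to_K]
  simp only [Complex.coe_algebraMap, ← Complex.ofReal_pow, ← Complex.ofReal_mul,
    ← Complex.ofReal_sub, Complex.ofReal_re]

/-- To compute the norm of `(π ⊗ τ)(x)` one may replace `τ` by a faithful family. -/
theorem norm_tensor_le_of_faithful (π : HilbertRep A) (F : Set (HilbertRep D))
    (hF : ∀ d : D, (∀ σ ∈ F, σ.toHom d = 0) → d = 0) (x : A ⊗[ℂ] D) {c : ℝ} (hc : 0 ≤ c)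
    (hx : ∀ σ ∈ F, ‖π.tensor σ x‖ ≤ c) (τ : HilbertRep D) : ‖π.tensor τ x‖ ≤ c := by
  let _ := CStarAlgebra.spectralOrder D
  have _ := CStarAlgebra.spectralOrderedRing D
  refine ContinuousLinearMap.opNorm_le_bound _ hc fun ζ => ?_
  refine HilbertTensor.denseRange_of.induction_on
    (p := fun ζ => ‖π.tensor τ x ζ‖ ≤ c * ‖ζ‖) ζ (isClosed_le (by fun_prop) (by fun_prop)) ?_
  intro ξ
  obtain ⟨n, k, g, rfl⟩ := TensorProduct.exists_sum_tmul_eq ξ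
  set y : A ⊗[ℂ] D := ((c ^ 2 : ℝ) : ℂ) • (1 : A ⊗[ℂ] D) - star x * x with hy
  have hys : star y = y := by
    rw [hy, star_sub, star_smul, star_one, star_mul, star_star, Complex.star_def,
      Complex.conj_ofReal]
  set Z : CStarMatrix (Fin n) (Fin n) D := sliceMatrix π k y with hZ
  have hZs : IsSelfAdjoint Z := by
    ext i j
    rw [CStarMatrix.star_apply, hZ, sliceMatrix_apply, sliceMatrix_apply, star_slice, hys]
  obtain ⟨Y, hY⟩ := exists_eq_star_mul_self F hF Z hZs fun σ hσ h => by
    rw [hZ, ← inner_tensor_sum, hy, re_inner_sub, sub_nonneg, ← mul_pow]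
    exact pow_le_pow_left₀ (norm_nonneg _) (ContinuousLinearMap.le_of_opNorm_le _ (hx σ hσ) _) 2
  have h1 := re_inner_sub π τ x c (HilbertTensor.of (∑ j, k j ⊗ₜ[ℂ] g j))
  rw [← hy, inner_tensor_sum, ← hZ, hY] at h1
  have h2 : 0 ≤ (∑ j, inner ℂ (g j) (τ.act (star Y * Y) g j)).re := by
    rw [act_mul, sum_inner_act_star, Complex.re_sum]
    refine Finset.sum_nonneg fun j _ => ?_
    exact inner_self_nonneg (𝕜 := ℂ)
  rw [h1, sub_nonneg, ← mul_pow] at h2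
  exact (sq_le_sq₀ (norm_nonneg _) (by positivity)).mp h2

end Faithful
end HilbertRep

namespace HilbertRep

variable {A B C : Type u} [CStarAlgebra A] [CStarAlgebra B] [CStarAlgebra C]

/-- The representation `π ⊗ ρ` of the minimal tensor product. -/
def prod (π : HilbertRep A) (ρ : HilbertRep B) : HilbertRep (MinTensor A B) where
  space := tensorSpace π ρ
  toHom := MinTensor.lift (π.tensor ρ) (MinTensor.norm_tensor_le π ρ)

theorem prod_ofAlg (π : HilbertRep A) (ρ : HilbertRep B) (x : A ⊗[ℂ] B) :
    (prod π ρ).toHom (MinTensor.ofAlg x) = π.tensor ρ x :=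
  MinTensor.lift_ofAlg (π.tensor ρ) (MinTensor.norm_tensor_le π ρ) x

/-- The representations `π ⊗ ρ` separate the points of the minimal tensor product. -/
theorem prod_faithful (d : MinTensor A B)
    (hd : ∀ (π : HilbertRep A) (ρ : HilbertRep B), (prod π ρ).toHom d = 0) : d = 0 := by
  have key : ∀ (x : A ⊗[ℂ] B), ‖(MinTensor.ofAlg x : MinTensor A B)‖ ≤
      ‖MinTensor.ofAlg x - d‖ := fun x => by
    rw [MinTensor.norm_ofAlg]
    refine MinTensor.minTensorNorm_le fun π ρ => ?_
    rw [← prod_ofAlg, ← sub_zero ((prod π ρ).toHom _), ← hd π ρ, ← map_sub]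
    exact NonUnitalStarAlgHom.norm_apply_le (prod π ρ).toHom _
  have key2 : ∀ y : MinTensor A B, ‖y‖ ≤ ‖y - d‖ := fun y =>
    MinTensor.denseRange_ofAlg.induction_on (p := fun y => ‖y‖ ≤ ‖y - d‖) y
      (isClosed_le (by fun_prop) (by fun_prop)) key
  simpa using key2 d

end HilbertRep

section Assoc

/-- Induction for threefold algebraic tensor products. -/
theorem tensor_induction₃ {A B C : Type*} [AddCommGroup A] [Module ℂ A] [AddCommGroup B]
    [Module ℂ B] [AddCommGroup C] [Module ℂ C] {p : (A ⊗[ℂ] B) ⊗[ℂ] C → Prop} (h0 : p 0)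
    (hadd : ∀ s t, p s → p t → p (s + t)) (h : ∀ a b c, p ((a ⊗ₜ[ℂ] b) ⊗ₜ[ℂ] c))
    (t : (A ⊗[ℂ] B) ⊗[ℂ] C) : p t := by
  induction t using TensorProduct.induction_on with
  | zero => exact h0
  | add s t hs ht => exact hadd s t hs ht
  | tmul x c =>
    induction x using TensorProduct.induction_on with
    | zero => rw [TensorProduct.zero_tmul]; exact h0
    | add s t hs ht => rw [TensorProduct.add_tmul]; exact hadd _ _ hs ht
    | tmul a b => exact h a b c

/-- The associator of algebraic tensor products, as a *-homomorphism. -/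
def tensorAssocAlg (A B C : Type*) [Ring A] [Algebra ℂ A] [StarRing A] [StarModule ℂ A]
    [Ring B] [Algebra ℂ B] [StarRing B] [StarModule ℂ B]
    [Ring C] [Algebra ℂ C] [StarRing C] [StarModule ℂ C] :
    (A ⊗[ℂ] B) ⊗[ℂ] C →⋆ₐ[ℂ] A ⊗[ℂ] (B ⊗[ℂ] C) where
  __ := (Algebra.TensorProduct.assoc ℂ ℂ ℂ A B C).toAlgHom
  map_star' t := by
    change Algebra.TensorProduct.assoc ℂ ℂ ℂ A B C (star t) =
      star (Algebra.TensorProduct.assoc ℂ ℂ ℂ A B C t)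
    refine tensor_induction₃ (p := fun t => Algebra.TensorProduct.assoc ℂ ℂ ℂ A B C (star t) =
      star (Algebra.TensorProduct.assoc ℂ ℂ ℂ A B C t)) ?_ (fun s t hs ht => ?_)
      (fun a b c => ?_) t
    · simp
    · rw [star_add, map_add, map_add, star_add, hs, ht]
    · simp

theorem tensorAssocAlg_tmul {A B C : Type*} [Ring A] [Algebra ℂ A] [StarRing A] [StarModule ℂ A]
    [Ring B] [Algebra ℂ B] [StarRing B] [StarModule ℂ B]
    [Ring C] [Algebra ℂ C] [StarRing C] [StarModule ℂ C] (a : A) (b : B) (c : C) :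
    tensorAssocAlg A B C ((a ⊗ₜ[ℂ] b) ⊗ₜ[ℂ] c) = a ⊗ₜ[ℂ] (b ⊗ₜ[ℂ] c) := rfl

namespace HilbertTensor

variable (H K L : Type u) [NormedAddCommGroup H] [InnerProductSpace ℂ H]
  [NormedAddCommGroup K] [InnerProductSpace ℂ K] [NormedAddCommGroup L] [InnerProductSpace ℂ L]

/-- The map `(x ⊗ y) ⊗ z ↦ (x ⊗ y) ⊗ z`. -/
def embL : (H ⊗[ℂ] K) ⊗[ℂ] L →ₗ[ℂ] HilbertTensor (HilbertTensor H K) L :=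
  of.toLinearMap ∘ₗ TensorProduct.map of.toLinearMap LinearMap.id

/-- The map `(x ⊗ y) ⊗ z ↦ x ⊗ (y ⊗ z)`. -/
def embR : (H ⊗[ℂ] K) ⊗[ℂ] L →ₗ[ℂ] HilbertTensor H (HilbertTensor K L) :=
  of.toLinearMap ∘ₗ TensorProduct.map LinearMap.id of.toLinearMap ∘ₗ
    (TensorProduct.assoc ℂ H K L).toLinearMap

variable {H K L}

theorem embL_tmul (x : H) (y : K) (z : L) :
    embL H K L ((x ⊗ₜ[ℂ] y) ⊗ₜ[ℂ] z) = of (of (x ⊗ₜ[ℂ] y) ⊗ₜ[ℂ] z) := rfl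

theorem embR_tmul (x : H) (y : K) (z : L) :
    embR H K L ((x ⊗ₜ[ℂ] y) ⊗ₜ[ℂ] z) = of (x ⊗ₜ[ℂ] of (y ⊗ₜ[ℂ] z)) := rfl

theorem continuous_of_tmul (x : H) : Continuous fun w : K => (of (x ⊗ₜ[ℂ] w) : HilbertTensor H K) :=
  of.continuous.comp (TensorProduct.mkL ℂ H K x).continuous

theorem denseRange_embR : DenseRange (embR H K L) := by
  let S : Submodule ℂ (HilbertTensor H (HilbertTensor K L)) :=
    (LinearMap.range (embR H K L)).topologicalClosure
  have hS : IsClosed (S : Set (HilbertTensor H (HilbertTensor K L))) :=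
    Submodule.isClosed_topologicalClosure _
  have hle : LinearMap.range (embR H K L) ≤ S := Submodule.le_topologicalClosure _
  have h1 : ∀ (x : H) (w : HilbertTensor K L), of (x ⊗ₜ[ℂ] w) ∈ S := fun x w => by
    refine denseRange_of.induction_on
      (p := fun w => (of (x ⊗ₜ[ℂ] w) : HilbertTensor H (HilbertTensor K L)) ∈ S) w
      (hS.preimage (continuous_of_tmul x)) fun κ => ?_
    induction κ using TensorProduct.induction_on with
    | zero => simp
    | add s t hs ht => rw [map_add, TensorProduct.tmul_add, map_add]; exact S.add_mem hs ht
    | tmul y z => exact hle ⟨(x ⊗ₜ[ℂ] y) ⊗ₜ[ℂ] z, rfl⟩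
  have h2 : ∀ ξ, ξ ∈ S := fun ξ => by
    refine denseRange_of.induction_on (p := fun ξ => ξ ∈ S) ξ hS fun ξ => ?_
    induction ξ using TensorProduct.induction_on with
    | zero => simp
    | add s t hs ht => rw [map_add]; exact S.add_mem hs ht
    | tmul x w => exact h1 x w
  exact fun ξ => h2 ξ

end HilbertTensor

namespace MinTensor

variable {A B C : Type u} [CStarAlgebra A] [CStarAlgebra B] [CStarAlgebra C]

variable (A B C) in
/-- The canonical map `(A ⊗ B) ⊗ C → (A ⊗ B) ⊗ C` from the algebraic to a minimal tensor product. -/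
def assocL : (A ⊗[ℂ] B) ⊗[ℂ] C →⋆ₐ[ℂ] MinTensor A B ⊗[ℂ] C :=
  tensorMapAlg ofAlg (StarAlgHom.id ℂ C)

variable (A B C) in
/-- The canonical map `(A ⊗ B) ⊗ C → A ⊗ (B ⊗ C)` from the algebraic to a minimal tensor product. -/
def assocR : (A ⊗[ℂ] B) ⊗[ℂ] C →⋆ₐ[ℂ] A ⊗[ℂ] MinTensor B C :=
  (tensorMapAlg (StarAlgHom.id ℂ A) ofAlg).comp (tensorAssocAlg A B C)

theorem assocL_tmul (a : A) (b : B) (c : C) :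
    assocL A B C ((a ⊗ₜ[ℂ] b) ⊗ₜ[ℂ] c) = tmul a b ⊗ₜ[ℂ] c := rfl

theorem assocR_tmul (a : A) (b : B) (c : C) :
    assocR A B C ((a ⊗ₜ[ℂ] b) ⊗ₜ[ℂ] c) = a ⊗ₜ[ℂ] tmul b c := rfl

/-- The map `(x ⊗ y) ⊗ z ↦ (x ⊗ y) ⊗ z` into the space of `(π ⊗ ρ) ⊗ σ`. -/
def repL (π : HilbertRep A) (ρ : HilbertRep B) (σ : HilbertRep C) :
    (π.space ⊗[ℂ] ρ.space) ⊗[ℂ] σ.space →ₗ[ℂ] HilbertRep.tensorSpace (π.prod ρ) σ :=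
  HilbertTensor.embL π.space ρ.space σ.space

/-- The map `(x ⊗ y) ⊗ z ↦ x ⊗ (y ⊗ z)` into the space of `π ⊗ (ρ ⊗ σ)`. -/
def repR (π : HilbertRep A) (ρ : HilbertRep B) (σ : HilbertRep C) :
    (π.space ⊗[ℂ] ρ.space) ⊗[ℂ] σ.space →ₗ[ℂ] HilbertRep.tensorSpace π (ρ.prod σ) :=
  HilbertTensor.embR π.space ρ.space σ.space

theorem tensor_repR (π : HilbertRep A) (ρ : HilbertRep B) (σ : HilbertRep C) (a : A) (b : B) (c : C)
    (x : π.space) (y : ρ.space) (z : σ.space) :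
    π.tensor (ρ.prod σ) (assocR A B C ((a ⊗ₜ[ℂ] b) ⊗ₜ[ℂ] c)) (repR π ρ σ ((x ⊗ₜ[ℂ] y) ⊗ₜ[ℂ] z)) =
      repR π ρ σ ((π.toHom a x ⊗ₜ[ℂ] ρ.toHom b y) ⊗ₜ[ℂ] σ.toHom c z) := by
  rw [assocR_tmul, HilbertRep.tensor_tmul, tmul, HilbertRep.prod_ofAlg, HilbertRep.tensor_tmul]
  refine (HilbertTensor.map_tmul (π.toHom a) (HilbertTensor.map (ρ.toHom b) (σ.toHom c)) x
    (HilbertTensor.of (y ⊗ₜ[ℂ] z))).trans ?_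
  rw [HilbertTensor.map_tmul]
  rfl

theorem tensor_repL (π : HilbertRep A) (ρ : HilbertRep B) (σ : HilbertRep C) (a : A) (b : B) (c : C)
    (x : π.space) (y : ρ.space) (z : σ.space) :
    (π.prod ρ).tensor σ (assocL A B C ((a ⊗ₜ[ℂ] b) ⊗ₜ[ℂ] c)) (repL π ρ σ ((x ⊗ₜ[ℂ] y) ⊗ₜ[ℂ] z)) =
      repL π ρ σ ((π.toHom a x ⊗ₜ[ℂ] ρ.toHom b y) ⊗ₜ[ℂ] σ.toHom c z) := by
  rw [assocL_tmul, HilbertRep.tensor_tmul, tmul, HilbertRep.prod_ofAlg, HilbertRep.tensor_tmul]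
  refine (HilbertTensor.map_tmul (HilbertTensor.map (π.toHom a) (ρ.toHom b)) (σ.toHom c)
    (HilbertTensor.of (x ⊗ₜ[ℂ] y)) z).trans ?_
  rw [HilbertTensor.map_tmul]
  rfl

theorem inner_repR_tmul (π : HilbertRep A) (ρ : HilbertRep B) (σ : HilbertRep C)
    (x x' : π.space) (y y' : ρ.space) (z z' : σ.space) :
    inner ℂ (repR π ρ σ ((x ⊗ₜ[ℂ] y) ⊗ₜ[ℂ] z)) (repR π ρ σ ((x' ⊗ₜ[ℂ] y') ⊗ₜ[ℂ] z')) =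
      inner ℂ x x' * inner ℂ y y' * inner ℂ z z' := by
  change inner ℂ (HilbertTensor.of (x ⊗ₜ[ℂ] HilbertTensor.of (y ⊗ₜ[ℂ] z)))
    (HilbertTensor.of (x' ⊗ₜ[ℂ] HilbertTensor.of (y' ⊗ₜ[ℂ] z'))) = _
  simp only [LinearIsometry.inner_map_map, TensorProduct.inner_tmul, mul_assoc]

theorem inner_repL_tmul (π : HilbertRep A) (ρ : HilbertRep B) (σ : HilbertRep C)
    (x x' : π.space) (y y' : ρ.space) (z z' : σ.space) :
    inner ℂ (repL π ρ σ ((x ⊗ₜ[ℂ] y) ⊗ₜ[ℂ] z)) (repL π ρ σ ((x' ⊗ₜ[ℂ] y') ⊗ₜ[ℂ] z')) =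
      inner ℂ x x' * inner ℂ y y' * inner ℂ z z' := by
  change inner ℂ (HilbertTensor.of (HilbertTensor.of (x ⊗ₜ[ℂ] y) ⊗ₜ[ℂ] z))
    (HilbertTensor.of (HilbertTensor.of (x' ⊗ₜ[ℂ] y') ⊗ₜ[ℂ] z')) = _
  simp only [LinearIsometry.inner_map_map, TensorProduct.inner_tmul]

/-- The matrix coefficients of the two iterated tensor products of representations agree. -/
theorem inner_assoc (π : HilbertRep A) (ρ : HilbertRep B) (σ : HilbertRep C)
    (s t : (A ⊗[ℂ] B) ⊗[ℂ] C) (ζ ζ' : (π.space ⊗[ℂ] ρ.space) ⊗[ℂ] σ.space) :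
    inner ℂ (π.tensor (ρ.prod σ) (assocR A B C s) (repR π ρ σ ζ))
      (π.tensor (ρ.prod σ) (assocR A B C t) (repR π ρ σ ζ')) =
    inner ℂ ((π.prod ρ).tensor σ (assocL A B C s) (repL π ρ σ ζ))
      ((π.prod ρ).tensor σ (assocL A B C t) (repL π ρ σ ζ')) := by
  revert s t ζ ζ'
  refine tensor_induction₃ ?_ ?_ ?_
  · intros
    simp only [map_zero, zero_apply, inner_zero_left]
  · intro s s' h h' t ζ ζ'
    simp only [map_add, add_apply, inner_add_left, h, h']
  intro a b c
  refine tensor_induction₃ ?_ ?_ ?_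
  · intros
    simp only [map_zero, zero_apply, inner_zero_right]
  · intro s s' h h' ζ ζ'
    simp only [map_add, add_apply, inner_add_right, h, h']
  intro a' b' c'
  refine tensor_induction₃ ?_ ?_ ?_
  · intros
    simp only [map_zero, inner_zero_left]
  · intro s s' h h' ζ'
    simp only [map_add, inner_add_left, h, h']
  intro x y z
  refine tensor_induction₃ ?_ ?_ ?_
  · simp only [map_zero, inner_zero_right]
  · intro s s' h h'
    simp only [map_add, inner_add_right, h, h']
  intro x' y' z'
  rw [tensor_repR, tensor_repR, tensor_repL, tensor_repL, inner_repR_tmul, inner_repL_tmul]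

theorem norm_assocR_le (t : (A ⊗[ℂ] B) ⊗[ℂ] C) :
    minTensorNorm A (MinTensor B C) (assocR A B C t) ≤
      minTensorNorm (MinTensor A B) C (assocL A B C t) := by
  refine minTensorNorm_le fun π τ => ?_
  refine HilbertRep.norm_tensor_le_of_faithful π
    (Set.range fun p : HilbertRep B × HilbertRep C => p.1.prod p.2)
    (fun d hd => HilbertRep.prod_faithful d fun ρ σ => hd _ ⟨(ρ, σ), rfl⟩) _
    (CStarSeminorm.nonneg _ _) ?_ τ
  rintro _ ⟨⟨ρ, σ⟩, rfl⟩
  refine le_trans ?_ (norm_tensor_le (π.prod ρ) σ _)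
  refine ContinuousLinearMap.opNorm_le_bound _ (norm_nonneg _) fun ζ => ?_
  have hd : DenseRange (repR π ρ σ) := HilbertTensor.denseRange_embR
  refine hd.induction_on (p := fun ζ =>
    ‖π.tensor (ρ.prod σ) (assocR A B C t) ζ‖ ≤
      ‖(π.prod ρ).tensor σ (assocL A B C t)‖ * ‖ζ‖) ζ (isClosed_le (by fun_prop) (by fun_prop)) ?_
  intro ζ
  have h1 : ∀ s, ‖π.tensor (ρ.prod σ) (assocR A B C s) (repR π ρ σ ζ)‖ =
      ‖(π.prod ρ).tensor σ (assocL A B C s) (repL π ρ σ ζ)‖ := fun s => by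
    rw [@norm_eq_sqrt_re_inner ℂ, @norm_eq_sqrt_re_inner ℂ, inner_assoc]
  have h2 := h1 1
  rw [map_one, map_one, map_one, map_one, one_apply_eq_self, one_apply_eq_self] at h2
  rw [h1, h2]
  exact ContinuousLinearMap.le_opNorm _ _

variable (A C) in
/-- The canonical embedding `x ↦ x ⊗ 1`. -/
def inl : A →⋆ₐ[ℂ] MinTensor A C where
  __ := (ofAlg : A ⊗[ℂ] C →⋆ₐ[ℂ] MinTensor A C).toAlgHom.comp
    (Algebra.TensorProduct.includeLeft : A →ₐ[ℂ] A ⊗[ℂ] C)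
  map_star' x := by
    change ofAlg (star x ⊗ₜ[ℂ] (1 : C)) = star (ofAlg (x ⊗ₜ[ℂ] (1 : C)))
    rw [← map_star, TensorProduct.star_tmul, star_one]

theorem tmul_eq_inl_mul (a : A) (c : C) : tmul a c = inl A C a * tmul 1 c := by
  change _ = ofAlg (a ⊗ₜ[ℂ] (1 : C)) * ofAlg ((1 : A) ⊗ₜ[ℂ] c)
  rw [← map_mul, Algebra.TensorProduct.tmul_mul_tmul, mul_one, one_mul, tmul]

theorem continuous_tmul_left (c : C) : Continuous fun a : A => tmul a c := by
  rw [show (fun a : A => tmul a c) = fun a => inl A C a * tmul 1 c from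
    funext fun a => tmul_eq_inl_mul a c]
  exact (map_continuous (inl A C)).mul continuous_const

theorem denseRange_assocL : DenseRange
    ((ofAlg : MinTensor A B ⊗[ℂ] C →⋆ₐ[ℂ] MinTensor (MinTensor A B) C).comp (assocL A B C)) := by
  let f : (A ⊗[ℂ] B) ⊗[ℂ] C →ₗ[ℂ] MinTensor (MinTensor A B) C :=
    ((ofAlg : MinTensor A B ⊗[ℂ] C →⋆ₐ[ℂ] MinTensor (MinTensor A B) C).comp
      (assocL A B C)).toAlgHom.toLinearMap
  let S : Submodule ℂ (MinTensor (MinTensor A B) C) := (LinearMap.range f).topologicalClosure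
  have hS : IsClosed (S : Set (MinTensor (MinTensor A B) C)) :=
    Submodule.isClosed_topologicalClosure _
  have h1 : ∀ (x : MinTensor A B) (c : C), tmul x c ∈ S := fun x c => by
    refine denseRange_ofAlg.induction_on (p := fun x : MinTensor A B => tmul x c ∈ S) x
      (hS.preimage (continuous_tmul_left c)) fun y => ?_
    exact Submodule.le_topologicalClosure _ ⟨y ⊗ₜ[ℂ] c, rfl⟩
  intro x
  refine denseRange_ofAlg.induction_on (p := fun x => x ∈ S) x hS fun y => ?_
  induction y using TensorProduct.induction_on with
  | zero => rw [map_zero]; exact S.zero_mem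
  | add s t hs ht => rw [map_add]; exact S.add_mem hs ht
  | tmul x c => exact h1 x c

/-- The associativity isomorphism `(A ⊗ B) ⊗ C → A ⊗ (B ⊗ C)`, `(a ⊗ b) ⊗ c ↦ a ⊗ (b ⊗ c)`, of
minimal tensor products. -/
def assoc (A B C : Type u) [CStarAlgebra A] [CStarAlgebra B] [CStarAlgebra C] :
    MinTensor (MinTensor A B) C →⋆ₐ[ℂ] MinTensor A (MinTensor B C) :=
  extendDense (ofAlg.comp (assocL A B C)) denseRange_assocL (ofAlg.comp (assocR A B C)) fun t => by
    rw [StarAlgHom.comp_apply, StarAlgHom.comp_apply, norm_ofAlg, norm_ofAlg]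
    exact norm_assocR_le t

theorem assoc_tmul (a : A) (b : B) (c : C) :
    assoc A B C (tmul (tmul a b) c) = tmul a (tmul b c) :=
  extendDense_apply _ _ _ _ ((a ⊗ₜ[ℂ] b) ⊗ₜ[ℂ] c)

end MinTensor
end Assoc

/-! ### Compact quantum groups and their co-actions on C*-algebras -/

/-- A compact quantum group: a unital C*-algebra with a co-associative co-product such that
`Δ(A)(1 ⊗ A)` and `Δ(A)(A ⊗ 1)` span dense subspaces of `A ⊗ A`. -/
structure CompactQuantumGroup (A : Type u) [CStarAlgebra A] where
  /-- the co-product -/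
  comul : A →⋆ₐ[ℂ] MinTensor A A
  coassoc : ∀ a : A, MinTensor.assoc A A A (MinTensor.map comul (StarAlgHom.id ℂ A) (comul a)) =
    MinTensor.map (StarAlgHom.id ℂ A) comul (comul a)
  dense_right : Dense (Submodule.span ℂ {x : MinTensor A A |
    ∃ a b : A, x = comul a * MinTensor.tmul 1 b} : Set (MinTensor A A))
  dense_left : Dense (Submodule.span ℂ {x : MinTensor A A |
    ∃ a b : A, x = comul a * MinTensor.tmul b 1} : Set (MinTensor A A))

/-- `γ : B → B ⊗ A` is a co-action of the compact quantum group `Q = (A, Δ)` on the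
C*-algebra `B`. -/
structure IsCoaction {A B : Type u} [CStarAlgebra A] [CStarAlgebra B] (Q : CompactQuantumGroup A)
    (γ : B →⋆ₐ[ℂ] MinTensor B A) : Prop where
  coassoc : ∀ b : B, MinTensor.assoc B A A (MinTensor.map γ (StarAlgHom.id ℂ A) (γ b)) =
    MinTensor.map (StarAlgHom.id ℂ B) Q.comul (γ b)
  dense : Dense (Submodule.span ℂ {x : MinTensor B A |
    ∃ (b : B) (a : A), x = γ b * MinTensor.tmul 1 a} : Set (MinTensor B A))

/-! ### The free *-algebra -/

/-- The free unital complex *-algebra on a set `X`: the linear span of the words in the letters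
`x = (x, false)` and `x* = (x, true)`. -/
def FreeStarAlgebra (X : Type u) : Type u := MonoidAlgebra ℂ (FreeMonoid (X × Bool))

namespace FreeStarAlgebra

variable {X : Type u}

instance : Ring (FreeStarAlgebra X) :=
  inferInstanceAs (Ring (MonoidAlgebra ℂ (FreeMonoid (X × Bool))))

instance : Algebra ℂ (FreeStarAlgebra X) :=
  inferInstanceAs (Algebra ℂ (MonoidAlgebra ℂ (FreeMonoid (X × Bool))))

/-- The adjoint of a word: reverse the word and exchange `x` and `x*`. -/
def starWord (w : FreeMonoid (X × Bool)) : FreeMonoid (X × Bool) :=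
  FreeMonoid.map (fun y => (y.1, !y.2)) (star w)

theorem starWord_mul (v w : FreeMonoid (X × Bool)) :
    starWord (v * w) = starWord w * starWord v := by
  simp [starWord]

theorem starWord_one : starWord (1 : FreeMonoid (X × Bool)) = 1 := by simp [starWord]

theorem starWord_of (y : X × Bool) :
    starWord (FreeMonoid.of y) = FreeMonoid.of (y.1, !y.2) := by simp [starWord]

theorem starWord_starWord (w : FreeMonoid (X × Bool)) : starWord (starWord w) = w := by
  induction w using FreeMonoid.inductionOn' with
  | one => rw [starWord_one, starWord_one]
  | of_mul y w hw => rw [starWord_mul, starWord_mul, starWord_of, starWord_of, hw, Bool.not_not]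

/-- The element of the free *-algebra given by a word. -/
def word (w : FreeMonoid (X × Bool)) : FreeStarAlgebra X :=
  MonoidAlgebra.of ℂ (FreeMonoid (X × Bool)) w

theorem word_mul (v w : FreeMonoid (X × Bool)) : word (v * w) = word v * word w :=
  map_mul (MonoidAlgebra.of ℂ (FreeMonoid (X × Bool))) v w

theorem word_one : word (1 : FreeMonoid (X × Bool)) = 1 :=
  map_one (MonoidAlgebra.of ℂ (FreeMonoid (X × Bool)))

theorem induction {p : FreeStarAlgebra X → Prop} (hw : ∀ w, p (word w))
    (hadd : ∀ x y, p x → p y → p (x + y)) (hsmul : ∀ (c : ℂ) x, p x → p (c • x))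
    (x : FreeStarAlgebra X) : p x :=
  MonoidAlgebra.induction_on (motive := p) x hw hadd hsmul

/-- The conjugate-linear anti-multiplicative map extending `starWord`. -/
def starHom : FreeStarAlgebra X →+* (FreeStarAlgebra X)ᵐᵒᵖ :=
  MonoidAlgebra.liftNCRingHom (k := ℂ) (G := FreeMonoid (X × Bool))
    ((algebraMap ℂ (FreeStarAlgebra X)ᵐᵒᵖ).comp (starRingEnd ℂ))
    { toFun := fun w => MulOpposite.op (word (starWord w))
      map_one' := by rw [starWord_one, word_one, MulOpposite.op_one]
      map_mul' := fun v w => by rw [starWord_mul, word_mul, MulOpposite.op_mul] }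
    fun c _ => Algebra.commutes (starRingEnd ℂ c) _

instance : Star (FreeStarAlgebra X) := ⟨fun x => (starHom x).unop⟩

theorem star_def (x : FreeStarAlgebra X) : star x = (starHom x).unop := rfl

theorem star_word (w : FreeMonoid (X × Bool)) : star (word w) = word (starWord w) := by
  rw [star_def, word, starHom, MonoidAlgebra.of_apply]
  exact (congrArg MulOpposite.unop (MonoidAlgebra.liftNC_single _ _ _ _)).trans (by simp)

theorem star_add' (x y : FreeStarAlgebra X) : star (x + y) = star x + star y := by
  rw [star_def, map_add, MulOpposite.unop_add]; rfl

theorem star_mul' (x y : FreeStarAlgebra X) : star (x * y) = star y * star x := by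
  rw [star_def, map_mul, MulOpposite.unop_mul]; rfl

theorem starHom_algebraMap (c : ℂ) :
    starHom (algebraMap ℂ (FreeStarAlgebra X) c) = algebraMap ℂ _ (starRingEnd ℂ c) := by
  refine (MonoidAlgebra.liftNC_single _ _ _ _).trans ?_
  simp [starWord_one, word_one]

theorem star_smul' (c : ℂ) (x : FreeStarAlgebra X) : star (c • x) = star c • star x := by
  rw [Algebra.smul_def, star_mul', star_def (algebraMap _ _ c), starHom_algebraMap,
    MulOpposite.algebraMap_apply, MulOpposite.unop_op, ← Algebra.commutes, ← Algebra.smul_def]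
  rfl

instance : StarRing (FreeStarAlgebra X) where
  star_involutive x := by
    refine induction (p := fun x => star (star x) = x) (fun w => ?_) (fun x y hx hy => ?_)
      (fun c x hx => ?_) x
    · rw [star_word, star_word, starWord_starWord]
    · rw [star_add', star_add', hx, hy]
    · rw [star_smul', star_smul', hx, star_star]
  star_mul := star_mul'
  star_add := star_add'

instance : StarModule ℂ (FreeStarAlgebra X) := ⟨star_smul'⟩

/-- The generator `x` of the free *-algebra. -/
def gen (x : X) : FreeStarAlgebra X := word (FreeMonoid.of (x, false))

variable {D : Type*} [CStarAlgebra D]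

theorem star_gen (x : X) : star (gen x) = word (FreeMonoid.of (x, true)) := by
  rw [gen, star_word, starWord_of]; rfl

/-- The underlying algebra homomorphism of `lift`. -/
def liftAlg (f : X → D) : FreeStarAlgebra X →ₐ[ℂ] D :=
  MonoidAlgebra.lift ℂ D (FreeMonoid (X × Bool))
    (FreeMonoid.lift fun y => if y.2 then star (f y.1) else f y.1)

theorem liftAlg_word (f : X → D) (w : FreeMonoid (X × Bool)) : liftAlg f (word w) =
    FreeMonoid.lift (fun y => if y.2 then star (f y.1) else f y.1) w :=
  MonoidAlgebra.lift_of _ _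

/-- The *-homomorphism from the free *-algebra that takes prescribed values on the generators. -/
def lift (f : X → D) : FreeStarAlgebra X →⋆ₐ[ℂ] D where
  __ := liftAlg f
  map_star' x := by
    change liftAlg f (star x) = star (liftAlg f x)
    refine induction (p := fun x => liftAlg f (star x) = star (liftAlg f x)) (fun w => ?_)
      (fun x y hx hy => ?_) (fun c x hx => ?_) x
    · rw [star_word]
      induction w using FreeMonoid.inductionOn' with
      | one => rw [starWord_one, word_one, map_one, star_one]
      | of_mul y w hw =>
        rw [starWord_mul, word_mul, word_mul, map_mul, map_mul, star_mul, hw, starWord_of,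
          liftAlg_word _ (FreeMonoid.of y), liftAlg_word _ (FreeMonoid.of _),
          FreeMonoid.lift_eval_of, FreeMonoid.lift_eval_of]
        rcases y with ⟨x, _ | _⟩ <;> simp
    · rw [star_add, map_add, map_add, star_add, hx, hy]
    · rw [star_smul, map_smul, map_smul, star_smul, hx]

theorem lift_gen (f : X → D) (x : X) : lift f (gen x) = f x :=
  (liftAlg_word f _).trans (by simp)

end FreeStarAlgebra

/-! ### Directed multigraphs and graph C*-algebras -/

/-- A directed multigraph with vertex set `V` and edge set `E`. -/
structure Multigraph (V E : Type u) where
  /-- the source map -/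
  source : E → V
  /-- the target map -/
  target : E → V

namespace Multigraph

variable {V E : Type u} [Fintype V] [DecidableEq V] [Fintype E] [DecidableEq E]

/-- Projections `P i` and partial isometries `S τ` in a unital C*-algebra that satisfy the relations
of the graph C*-algebra; the `P i` sum up to the unit. -/
structure IsFamily (Γ : Multigraph V E) {D : Type*} [CStarAlgebra D] (P : V → D) (S : E → D) :
    Prop where
  isStarProjection : ∀ i, IsStarProjection (P i)
  mul_eq_zero : ∀ i j, i ≠ j → P i * P j = 0
  sum_eq_one : ∑ i, P i = 1
  partialIsometry : ∀ τ, S τ * star (S τ) * S τ = S τ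
  star_mul_self : ∀ τ, star (S τ) * S τ = P (Γ.target τ)
  sum_mul_star : ∀ i ∈ Set.range Γ.source, ∑ τ with Γ.source τ = i, S τ * star (S τ) = P i

variable (Γ : Multigraph V E)

/-- The generator of the free *-algebra that belongs to a vertex. -/
def genP (i : V) : FreeStarAlgebra (V ⊕ E) := FreeStarAlgebra.gen (Sum.inl i)

/-- The generator of the free *-algebra that belongs to an edge. -/
def genS (τ : E) : FreeStarAlgebra (V ⊕ E) := FreeStarAlgebra.gen (Sum.inr τ)

/-- `φ` maps the generators to a family as in `IsFamily`. -/
def Represents {D : Type*} [CStarAlgebra D] (φ : FreeStarAlgebra (V ⊕ E) →⋆ₐ[ℂ] D) : Prop :=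
  Γ.IsFamily (fun i => φ (genP i)) (fun τ => φ (genS τ))

variable {Γ} in
theorem Represents.of_ker {ι : Sort*} {D : ι → Type*} [∀ k, CStarAlgebra (D k)]
    {φ : ∀ k, FreeStarAlgebra (V ⊕ E) →⋆ₐ[ℂ] D k} (hφ : ∀ k, Γ.Represents (φ k))
    {D' : Type*} [CStarAlgebra D'] {ψ : FreeStarAlgebra (V ⊕ E) →⋆ₐ[ℂ] D'}
    (h : ∀ x, (∀ k, φ k x = 0) → ψ x = 0) : Γ.Represents ψ := by
  have key : ∀ x y, (∀ k, φ k x = φ k y) → ψ x = ψ y := fun x y hxy => by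
    rw [← sub_eq_zero, ← map_sub]
    exact h _ fun k => by rw [map_sub, hxy, sub_self]
  constructor
  · intro i
    constructor
    · have := key (genP i * genP i) (genP i) fun k => by
        rw [map_mul]; exact ((hφ k).isStarProjection i).isIdempotentElem
      rwa [map_mul] at this
    · have := key (star (genP i)) (genP i) fun k => by
        rw [map_star]; exact ((hφ k).isStarProjection i).isSelfAdjoint
      rwa [map_star] at this
  · intro i j hij
    have := key (genP i * genP j) 0 fun k => by
      rw [map_mul, map_zero]; exact (hφ k).mul_eq_zero i j hij
    rwa [map_mul, map_zero] at this
  · have := key (∑ i, genP i) 1 fun k => by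
      rw [map_sum, map_one]; exact (hφ k).sum_eq_one
    rwa [map_sum, map_one] at this
  · intro τ
    have := key (genS τ * star (genS τ) * genS τ) (genS τ) fun k => by
      rw [map_mul, map_mul, map_star]; exact (hφ k).partialIsometry τ
    rwa [map_mul, map_mul, map_star] at this
  · intro τ
    have := key (star (genS τ) * genS τ) (genP (Γ.target τ)) fun k => by
      rw [map_mul, map_star]; exact (hφ k).star_mul_self τ
    rwa [map_mul, map_star] at this
  · intro i hi
    have := key (∑ τ with Γ.source τ = i, genS τ * star (genS τ)) (genP i) fun k => by
      simp only [map_sum, map_mul, map_star]; exact (hφ k).sum_mul_star i hi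
    simpa only [map_sum, map_mul, map_star] using this

/-- The C*-seminorms on the free *-algebra in whose completion the relations of the graph
C*-algebra hold. -/
def GraphSeminorm : Type u :=
  {N : CStarSeminorm (FreeStarAlgebra (V ⊕ E)) // Γ.Represents N.coeHom}

instance : Nonempty Γ.GraphSeminorm := by
  let N : CStarSeminorm (FreeStarAlgebra (V ⊕ E)) :=
    { (0 : Seminorm ℂ (FreeStarAlgebra (V ⊕ E))) with
      mul_le' := fun _ _ => (mul_zero (0 : ℝ)).ge
      star_mul_self' := fun _ => (mul_zero (0 : ℝ)).symm }
  refine ⟨⟨N, Represents.of_ker (ι := PEmpty.{1}) (D := fun _ => ℂ) (φ := fun k => k.elim)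
    (fun k => k.elim) fun x _ => ?_⟩⟩
  rw [← norm_eq_zero, CStarSeminorm.norm_coeHom]
  rfl

theorem IsFamily.norm_P_le {Γ : Multigraph V E} {D : Type*} [CStarAlgebra D] {P : V → D}
    {S : E → D} (h : Γ.IsFamily P S) (i : V) : ‖P i‖ ≤ 1 :=
  (h.isStarProjection i).norm_le

theorem IsFamily.norm_S_le {Γ : Multigraph V E} {D : Type*} [CStarAlgebra D] {P : V → D}
    {S : E → D} (h : Γ.IsFamily P S) (τ : E) : ‖S τ‖ ≤ 1 := by
  have h1 : ‖S τ‖ * ‖S τ‖ ≤ 1 := by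
    rw [← CStarRing.norm_star_mul_self, h.star_mul_self]
    exact h.norm_P_le _
  nlinarith [norm_nonneg (S τ)]

theorem bddAbove_graphSeminorm (x : FreeStarAlgebra (V ⊕ E)) :
    BddAbove (Set.range fun N : Γ.GraphSeminorm => N.1 x) := by
  have hgen : ∀ (N : Γ.GraphSeminorm) (y : (V ⊕ E) × Bool),
      N.1 (FreeStarAlgebra.word (FreeMonoid.of y)) ≤ 1 := by
    rintro N ⟨y, b⟩
    have h1 : N.1 (FreeStarAlgebra.gen y) ≤ 1 := by
      rw [← CStarSeminorm.norm_coeHom]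
      rcases y with i | τ
      · exact N.2.norm_P_le i
      · exact N.2.norm_S_le τ
    cases b with
    | false => exact h1
    | true => rw [← FreeStarAlgebra.star_gen, N.1.apply_star]; exact h1
  refine FreeStarAlgebra.induction
    (p := fun x => BddAbove (Set.range fun N : Γ.GraphSeminorm => N.1 x)) (fun w => ?_) ?_ ?_ x
  · refine ⟨1, ?_⟩
    rintro _ ⟨N, rfl⟩
    induction w using FreeMonoid.inductionOn' with
    | one =>
      change N.1 _ ≤ 1
      rw [FreeStarAlgebra.word_one, ← CStarSeminorm.norm_coeHom, map_one]
      have h := CStarRing.norm_star_mul_self (x := (1 : N.1.Completed))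
      rw [star_one, one_mul] at h
      nlinarith [norm_nonneg (1 : N.1.Completed)]
    | of_mul y w hw =>
      change N.1 _ ≤ 1
      rw [FreeStarAlgebra.word_mul]
      exact (N.1.mul_le _ _).trans (mul_le_one₀ (hgen N y) (N.1.nonneg _) hw)
  · rintro x y ⟨c, hc⟩ ⟨d, hd⟩
    refine ⟨c + d, ?_⟩
    rintro _ ⟨N, rfl⟩
    exact (map_add_le_add N.1.toSeminorm x y).trans (add_le_add (hc ⟨N, rfl⟩) (hd ⟨N, rfl⟩))
  · rintro a x ⟨c, hc⟩
    refine ⟨‖a‖ * c, ?_⟩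
    rintro _ ⟨N, rfl⟩
    exact (map_smul_eq_mul N.1.toSeminorm a x).trans_le
      (mul_le_mul_of_nonneg_left (hc ⟨N, rfl⟩) (norm_nonneg a))

/-- The largest C*-seminorm on the free *-algebra for which the relations of the graph C*-algebra
hold. -/
def graphNorm : CStarSeminorm (FreeStarAlgebra (V ⊕ E)) :=
  CStarSeminorm.sup (fun N : Γ.GraphSeminorm => N.1) Γ.bddAbove_graphSeminorm

/-- The graph C*-algebra `C*(Γ)`: the universal C*-algebra generated by projections `p i` and
partial isometries `s τ` with the relations `IsFamily`. -/
def GraphCStarAlgebra : Type u := Γ.graphNorm.Completed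

namespace GraphCStarAlgebra

instance : CStarAlgebra Γ.GraphCStarAlgebra := inferInstanceAs (CStarAlgebra Γ.graphNorm.Completed)

/-- The canonical projection of a vertex. -/
def p (i : V) : Γ.GraphCStarAlgebra := Γ.graphNorm.coeHom (genP i)

/-- The canonical partial isometry of an edge. -/
def s (τ : E) : Γ.GraphCStarAlgebra := Γ.graphNorm.coeHom (genS τ)

theorem isFamily : Γ.IsFamily (p Γ) (s Γ) := by
  refine Represents.of_ker (ι := Γ.GraphSeminorm) (D := fun N => N.1.Completed)
    (φ := fun N => N.1.coeHom) (fun N => N.2) fun x hx => ?_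
  refine norm_eq_zero.mp ((CStarSeminorm.norm_coeHom _ x).trans ?_)
  have h : ∀ N : Γ.GraphSeminorm, N.1 x = 0 := fun N => by
    rw [← CStarSeminorm.norm_coeHom, hx N, norm_zero]
  change ⨆ N : Γ.GraphSeminorm, N.1 x = 0
  simp only [h, ciSup_const]

variable {Γ} {D : Type u} [CStarAlgebra D] {P : V → D} {S : E → D}

theorem represents_lift (h : Γ.IsFamily P S) :
    Γ.Represents (FreeStarAlgebra.lift (Sum.elim P S)) := by
  have hP : (fun i => FreeStarAlgebra.lift (Sum.elim P S) (genP i)) = P :=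
    funext fun i => FreeStarAlgebra.lift_gen _ _
  have hS : (fun τ => FreeStarAlgebra.lift (Sum.elim P S) (genS τ)) = S :=
    funext fun i => FreeStarAlgebra.lift_gen _ _
  rw [Represents, hP, hS]
  exact h

/-- The universal property of the graph C*-algebra. -/
def lift (h : Γ.IsFamily P S) : Γ.GraphCStarAlgebra →⋆ₐ[ℂ] D :=
  Γ.graphNorm.lift (FreeStarAlgebra.lift (Sum.elim P S)) fun x => by
    let N := CStarSeminorm.ofStarAlgHom (FreeStarAlgebra.lift (Sum.elim P S))
    have hN : Γ.Represents N.coeHom := by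
      refine Represents.of_ker (ι := Unit) (fun _ => represents_lift h) fun y hy => ?_
      rw [← norm_eq_zero, CStarSeminorm.norm_coeHom, CStarSeminorm.ofStarAlgHom_apply, hy (),
        norm_zero]
    exact le_ciSup (Γ.bddAbove_graphSeminorm x) ⟨N, hN⟩

theorem lift_p (h : Γ.IsFamily P S) (i : V) : lift h (p Γ i) = P i :=
  (CStarSeminorm.lift_coeHom _ _ _ _).trans (FreeStarAlgebra.lift_gen _ _)

theorem lift_s (h : Γ.IsFamily P S) (τ : E) : lift h (s Γ τ) = S τ :=
  (CStarSeminorm.lift_coeHom _ _ _ _).trans (FreeStarAlgebra.lift_gen _ _)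

end GraphCStarAlgebra

end Multigraph

/-! ### Co-actions on a multigraph preserving its quantum symmetry in Banica's sense

The Hilbert space `L²(E)` consists of the functions `E → ℂ` with orthonormal basis `χ_τ`, and
`L²(E) ⊗ A`, `B(L²(E)) ⊗ A` and `C(X) ⊗ A` are identified with `E → A`, `Matrix E E A` and
`X → A`, for finite sets `E` and `X`. -/

section Banica

variable {V E A : Type u} [Fintype V] [DecidableEq V] [Fintype E] [DecidableEq E] [CStarAlgebra A]

/-- The matrix `(u^σ_τ)` of a linear map `β : L²(E) → L²(E) ⊗ A`,
`β(χ_τ) = ∑ σ, χ_σ ⊗ u^σ_τ`. -/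
def corepMatrix (β : (E → ℂ) →ₗ[ℂ] (E → A)) : Matrix E E A :=
  Matrix.of fun σ τ => β (Pi.single τ 1) σ

/-- `Ad(T) = U (T ⊗ 1) U*` for `T` in `B(L²(E))`. -/
def adjointAction (U : Matrix E E A) (T : Matrix E E ℂ) : Matrix E E A :=
  U * T.map (algebraMap ℂ A) * star U

/-- The multiplication operator on `L²(E)` by `f ∘ r`, for a map `r : E → V` and a function `f` on
the image of `r`, with values in `ℂ` or in `A`. -/
def mulOperator {R : Type*} [Zero R] (r : E → V) (f : Set.range r → R) : Matrix E E R :=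
  Matrix.diagonal fun τ => f ⟨r τ, τ, rfl⟩

/-- The adjoint action of `U` maps the multiplication operators by functions on the image of `r`
into the tensor product of the algebra of these operators with `A`. -/
def PreservesFunctions (U : Matrix E E A) (r : E → V) : Prop :=
  ∀ f : Set.range r → ℂ, ∃ F : Set.range r → A,
    adjointAction U (mulOperator r f) = mulOperator r F

/-- The map `C(r(E)) → C(r(E)) ⊗ A` induced by the adjoint action of `U`. -/
def inducedMap {U : Matrix E E A} {r : E → V} (h : PreservesFunctions U r)
    (f : Set.range r → ℂ) : Set.range r → A :=
  (h f).choose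

theorem inducedMap_spec {U : Matrix E E A} {r : E → V} (h : PreservesFunctions U r)
    (f : Set.range r → ℂ) : adjointAction U (mulOperator r f) = mulOperator r (inducedMap h f) :=
  (h f).choose_spec

theorem mulOperator_injective {R : Type*} [Zero R] (r : E → V) :
    Function.Injective (mulOperator r : (Set.range r → R) → Matrix E E R) := by
  rintro f g h
  funext ⟨_, τ, rfl⟩
  exact congrFun (Matrix.diagonal_injective h) τ

theorem inducedMap_unique {U : Matrix E E A} {r : E → V} (h : PreservesFunctions U r)
    {f : Set.range r → ℂ} {F : Set.range r → A}
    (hF : adjointAction U (mulOperator r f) = mulOperator r F) : inducedMap h f = F :=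
  mulOperator_injective r ((inducedMap_spec h f).symm.trans hF)

/-- `β : L²(E) → L²(E) ⊗ A` is a co-action of the compact quantum group `Q = (A, Δ)` on the
multigraph `Γ` preserving its quantum symmetry in Banica's sense. -/
structure IsBanicaCoaction (Q : CompactQuantumGroup A) (Γ : Multigraph V E)
    (β : (E → ℂ) →ₗ[ℂ] (E → A)) : Prop where
  /-- `β` is a co-representation -/
  corep : ∀ σ τ, Q.comul (corepMatrix β σ τ) =
    ∑ ρ, MinTensor.tmul (corepMatrix β σ ρ) (corepMatrix β ρ τ)
  /-- `β` is unitary -/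
  mem_unitary : corepMatrix β ∈ unitary (Matrix E E A)
  /-- the adjoint co-representation is unitary -/
  map_star_mem_unitary : (corepMatrix β).map star ∈ unitary (Matrix E E A)
  source : PreservesFunctions (corepMatrix β) Γ.source
  target : PreservesFunctions ((corepMatrix β).map star) Γ.target
  /-- the induced co-action on the functions on the sources preserves the functions supported on
  the vertices that are both sources and targets -/
  source_preserves : ∀ f : Set.range Γ.source → ℂ,
    (∀ v, v.1 ∉ Set.range Γ.target → f v = 0) →
      ∀ v, v.1 ∉ Set.range Γ.target → inducedMap source f v = 0
  /-- the same for the induced co-action on the functions on the targets -/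
  target_preserves : ∀ f : Set.range Γ.target → ℂ,
    (∀ v, v.1 ∉ Set.range Γ.source → f v = 0) →
      ∀ v, v.1 ∉ Set.range Γ.source → inducedMap target f v = 0
  /-- the two induced co-actions agree on these functions -/
  agree : ∀ f : V → ℂ, (∀ v, v ∉ Set.range Γ.source ∩ Set.range Γ.target → f v = 0) →
    ∀ (v : V) (hs : v ∈ Set.range Γ.source) (ht : v ∈ Set.range Γ.target),
      inducedMap source (fun w => f w) ⟨v, hs⟩ = inducedMap target (fun w => f w) ⟨v, ht⟩
  /-- `β` fixes the sum of all `χ_τ` -/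
  fixes : β (fun _ => 1) = fun _ => 1

open Classical in
/-- The function `α(χ_k)` in `C(V) ⊗ A` for the induced co-action `α` on `C(V)`: it is given by the
induced co-action on the functions on the sources if `k` is a source, and by the one on the
functions on the targets if `k` is a target. -/
def inducedVertexMap {Q : CompactQuantumGroup A} {Γ : Multigraph V E}
    {β : (E → ℂ) →ₗ[ℂ] (E → A)} (h : IsBanicaCoaction Q Γ β) (k : V) : V → A :=
  if k ∈ Set.range Γ.source then
    Function.extend Subtype.val (inducedMap h.source fun w => (Pi.single k 1 : V → ℂ) w) 0
  else
    Function.extend Subtype.val (inducedMap h.target fun w => (Pi.single k 1 : V → ℂ) w) 0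

/-- The matrix `(q^k_i)` of the induced co-action on `C(V)`, `α(χ_i) = ∑ k, χ_k ⊗ q^k_i`. -/
def inducedVertexMatrix {Q : CompactQuantumGroup A} {Γ : Multigraph V E}
    {β : (E → ℂ) →ₗ[ℂ] (E → A)} (h : IsBanicaCoaction Q Γ β) : Matrix V V A :=
  Matrix.of fun k i => inducedVertexMap h i k

end Banica

end

/-! By the universal property of $C^*(\Gamma)$ it suffices that $P_i=\sum_k p_k\otimes q^k_i$ and
$S_\tau=\sum_\sigma s_\sigma\otimes u^\sigma_\tau$ satisfy the graph relations
(`isFamily_coaction`).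

Comparing entries in $Ad_\beta(S(\chi_i))$ gives $\sum_{s(\tau)=i}u^\sigma_\tau
u^{\rho*}_\tau=\delta_{\sigma\rho}\,q^{s(\sigma)}_i$ (`sum_fiber_mul_star`), and this is exactly
what turns $\sum_{s(\tau)=i}S_\tau S_\tau^*$ into $P_i$. The relation $S_\tau^*S_\tau=P_{t(\tau)}$
is harder: after the ranges of the $s_\sigma$ are seen to be orthogonal, it needs an identity for
columns of $\overline U$ instead of rows, $\sum_{t(\sigma)=k}u^{\sigma*}_\tau
u^\sigma_\tau=q^k_{t(\tau)}$ (`sum_fiber_mul_star_col`). This follows once the projections in each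
column of the target block of $q$ add up to $1$, hence are orthogonal.

Column sums come from the fixed vector $\xi_0$. All row and column sums of $\overline U$ are $1$, so
$q^{t(\sigma)}_i$ is a partial row sum of $\overline U$, and the columns of $q$ add up correctly
when the $k$-th row is weighted by the number of edges in the fibre over $k$. For a matrix of
projections whose rows sum to $1$, a positivity argument removes the weights (`sum_col_eq_one`).

The relation $\sum_iP_i=1$ and the orthogonality of the $P_i$ require the full rows of $q$ over $V$
to sum to $1$. This is known only for the source block and the target block separately; a counting
argument on $V^s\cap V^t$ shows that $q^k_i=0$ for $k$ a source and $i$ not a source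
(`vertexMatrix_eq_zero`), which glues the blocks.

Finally, without isolated vertices the $s_\tau$ generate $C^*(\Gamma)$ as a C*-algebra, so
co-associativity can be checked on them. Density holds because the $b$ with $b\otimes1$ in the
closed span of $\gamma(B)(1\otimes\mathcal A)$ form a closed subalgebra, which contains $s_\rho$
since $UU^*=1$ and $s_\rho^*$ since $\overline U\,\overline U^{\,*}=1$. -/

noncomputable section

/-! ### Projections in a C*-algebra and matrices of projections -/

section StarProjections

variable {A X : Type*} [CStarAlgebra A] [Fintype X]

theorem IsStarProjection.star_mul_self_mul {p q : A} (hp : IsStarProjection p)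
    (hq : IsStarProjection q) : star (p * q) * (p * q) = q * p * q := by
  rw [star_mul, hp.isSelfAdjoint.star_eq, hq.isSelfAdjoint.star_eq]
  rw [mul_assoc, ← mul_assoc p p q, hp.isIdempotentElem.eq, mul_assoc]

/-- A finite sum of star projections vanishes only if all of them do. -/
theorem IsStarProjection.eq_zero_of_sum_eq_zero {ι : Type*} {s : Finset ι} {q : ι → A}
    (hq : ∀ i ∈ s, IsStarProjection (q i)) (hs : ∑ i ∈ s, q i = 0) {i : ι} (hi : i ∈ s) :
    q i = 0 := by
  let _ := CStarAlgebra.spectralOrder A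
  have _ := CStarAlgebra.spectralOrderedRing A
  exact (Finset.sum_eq_zero_iff_of_nonneg fun i hi => (hq i hi).nonneg).mp hs i hi

/-- Star projections that sum up to one are mutually orthogonal. -/
theorem IsStarProjection.mul_eq_zero_of_sum_eq_one {q : X → A}
    (hq : ∀ i, IsStarProjection (q i)) (hs : ∑ i, q i = 1) {i j : X} (hij : i ≠ j) :
    q i * q j = 0 := by
  classical
  let _ := CStarAlgebra.spectralOrder A
  have _ := CStarAlgebra.spectralOrderedRing A
  -- Compressing $\sum_l q_l=1$ by $q_j$ gives $\sum_l q_jq_lq_j=q_j$. The term $l=j$ already equals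
  -- $q_j$, so the remaining positive terms sum to zero and each of them vanishes.
  have h1 : ∑ l, star (q l * q j) * (q l * q j) = q j := by
    simp_rw [fun l => (hq l).star_mul_self_mul (hq j)]
    rw [← Finset.sum_mul, ← Finset.mul_sum, hs, mul_one, (hq j).isIdempotentElem.eq]
  rw [← Finset.add_sum_erase _ _ (Finset.mem_univ j), (hq j).star_mul_self_mul (hq j),
    (hq j).isIdempotentElem.eq, (hq j).isIdempotentElem.eq, add_eq_left,
    Finset.sum_eq_zero_iff_of_nonneg fun l _ => star_mul_self_nonneg _] at h1
  exact (CStarRing.star_mul_self_eq_zero_iff _).mp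
    (h1 i (Finset.mem_erase.mpr ⟨hij, Finset.mem_univ i⟩))

/-- If the rows of a matrix of star projections sum up to one, and the columns do so for weights
`N`, then the columns sum up to one. -/
theorem sum_col_eq_one {q : X → X → A} (hq : ∀ k j, IsStarProjection (q k j))
    (hrow : ∀ k, ∑ j, q k j = 1) {N : X → ℝ} (hN : ∀ k, 0 < N k)
    (hcol : ∀ j, ∑ k, N k • q k j = N j • (1 : A)) (j : X) : ∑ k, q k j = 1 := by
  let _ := CStarAlgebra.spectralOrder A
  have _ := CStarAlgebra.spectralOrderedRing A
  -- A single term is dominated by the weighted column sum $N_j\cdot1$; compressing this inequality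
  -- by the projection $q_{kj}$ itself puts $q_{kj}$ on the right.
  have h1 : ∀ k j, N k • q k j ≤ N j • q k j := fun k j => by
    have h2 : N k • q k j ≤ N j • (1 : A) := by
      rw [← hcol j]
      exact Finset.single_le_sum (f := fun k => N k • q k j)
        (fun l _ => smul_nonneg (hN l).le (hq l j).nonneg) (Finset.mem_univ k)
    have h3 := star_left_conjugate_le_conjugate h2 (q k j)
    simpa [(hq k j).isSelfAdjoint.star_eq, (hq k j).isIdempotentElem.eq] using h3
  -- The extra weight $N_k$ is chosen so that both halves equal $\sum_jN_j^2$: one by the column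
  -- sums, the other by the row sums. A zero sum of positive terms forces $N_kq_{kj}=N_jq_{kj}$, so
  -- in column $j$ every weight may be replaced by the constant $N_j$.
  have h2 : ∑ k, ∑ j, N k • (N j • q k j - N k • q k j) = 0 := by
    simp only [smul_sub, Finset.sum_sub_distrib]
    have h3 : ∑ k, ∑ j, N k • N j • q k j = ∑ j, (N j * N j) • (1 : A) := by
      rw [Finset.sum_comm]
      refine Finset.sum_congr rfl fun j _ => ?_
      rw [mul_smul, ← hcol j, Finset.smul_sum]
      exact Finset.sum_congr rfl fun k _ => smul_comm _ _ _
    have h4 : ∑ k, ∑ j, N k • N k • q k j = ∑ j, (N j * N j) • (1 : A) := by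
      refine Finset.sum_congr rfl fun k _ => ?_
      rw [← Finset.smul_sum, ← Finset.smul_sum, hrow, mul_smul]
    rw [h3, h4, sub_self]
  have h0 : ∀ k j, 0 ≤ N k • (N j • q k j - N k • q k j) := fun k j =>
    smul_nonneg (hN k).le (sub_nonneg.mpr (h1 k j))
  have h3 : ∀ k, N k • q k j = N j • q k j := fun k => by
    have h4 := (Finset.sum_eq_zero_iff_of_nonneg fun k _ =>
      Finset.sum_nonneg fun j _ => h0 k j).mp h2 k (Finset.mem_univ k)
    have h5 := (Finset.sum_eq_zero_iff_of_nonneg fun j _ => h0 k j).mp h4 j (Finset.mem_univ j)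
    exact (sub_eq_zero.mp ((smul_eq_zero.mp h5).resolve_left (hN k).ne')).symm
  have h4 := hcol j
  simp only [h3, ← Finset.smul_sum] at h4
  exact smul_right_injective A (hN j).ne' h4

/-- An element `a` for which `a* a` is a projection is a partial isometry. -/
theorem mul_star_mul_self_of_isStarProjection {a : A} (h : IsStarProjection (star a * a)) :
    a * star a * a = a := by
  have h1 : (star a * a) * (star a * a) = star a * a := h.isIdempotentElem.eq
  rw [← sub_eq_zero, ← CStarRing.star_mul_self_eq_zero_iff]
  have h2 : star (a * star a * a - a) * (a * star a * a - a) =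
      (star a * a) * (star a * a) * (star a * a) - (star a * a) * (star a * a) -
        ((star a * a) * (star a * a) - star a * a) := by
    simp only [star_sub, star_mul, star_star]
    noncomm_ring
  rw [h2, h1, h1, sub_self]

end StarProjections

/-! ### The magic unitary induced on the vertices in the image of one endpoint map -/

section InducedMatrix

variable {V E A : Type u} [Fintype V] [DecidableEq V] [Fintype E] [DecidableEq E] [CStarAlgebra A]

/-- The matrix of the map on functions that is induced by the adjoint action of `W`. -/
def inducedMatrix {W : Matrix E E A} {r : E → V} (h : PreservesFunctions W r)
    (k i : Set.range r) : A :=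
  inducedMap h (fun w => (Pi.single i.1 1 : V → ℂ) w) k

variable {W : Matrix E E A} {r : E → V} (h : PreservesFunctions W r)

/-- The left side is the $(\sigma,\tau)$ entry of $W(\chi_i\circ r\otimes1)W^*$, which is a diagonal
matrix by hypothesis. -/
theorem sum_fiber_mul_star (σ τ : E) (i : Set.range r) :
    ∑ ρ with r ρ = i, W σ ρ * star (W τ ρ) =
      if σ = τ then inducedMatrix h (Set.rangeFactorization r σ) i else 0 := by
  have h1 := congrFun (congrFun (inducedMap_spec h fun w => (Pi.single i.1 1 : V → ℂ) w) σ) τ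
  refine Eq.trans ?_ (h1.trans (Matrix.diagonal_apply _ _ _))
  rw [adjointAction, Matrix.mul_apply, Finset.sum_filter]
  refine Finset.sum_congr rfl fun ρ _ => ?_
  rw [mulOperator, Matrix.diagonal_map (map_zero _), Matrix.mul_diagonal, Matrix.star_apply,
    Pi.single_apply]
  split_ifs <;> simp

/-- Entrywise form of the intertwining relation $Ad_W(X)\,W=W(X\otimes1)$ with $X$ multiplication by
$\chi_i\circ r$. It says that $q^{r(\sigma)}_i$ fixes or annihilates $W_{\sigma\tau}$ according to
$r(\tau)$. -/
theorem inducedMatrix_mul (hW : W ∈ unitary (Matrix E E A)) (σ τ : E) (i : Set.range r) :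
    inducedMatrix h (Set.rangeFactorization r σ) i * W σ τ = if r τ = i then W σ τ else 0 := by
  have h1 : adjointAction W (mulOperator r fun w => (Pi.single i.1 1 : V → ℂ) w) * W =
      W * (mulOperator r fun w => (Pi.single i.1 1 : V → ℂ) w).map (algebraMap ℂ A) := by
    rw [adjointAction, mul_assoc, Unitary.star_mul_self_of_mem hW, mul_one]
  rw [inducedMap_spec h, mulOperator, mulOperator, Matrix.diagonal_map (map_zero _)] at h1
  have h2 := congrFun (congrFun h1 σ) τ
  rw [Matrix.mul_diagonal, Matrix.diagonal_mul, Pi.single_apply] at h2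
  refine Eq.trans h2 ?_
  split_ifs <;> simp

theorem isStarProjection_inducedMatrix (hW : W ∈ unitary (Matrix E E A)) (k i : Set.range r) :
    IsStarProjection (inducedMatrix h k i) := by
  obtain ⟨_, σ, rfl⟩ := k
  have h1 := sum_fiber_mul_star h σ σ i
  rw [if_pos rfl] at h1
  change IsStarProjection (inducedMatrix h (Set.rangeFactorization r σ) i)
  constructor
  -- Expand only the second factor as $\sum_{r(\rho)=i}W_{\sigma\rho}W_{\sigma\rho}^*$; the first
  -- factor then acts as the identity on every $W_{\sigma\rho}$.
  · refine (congrArg (inducedMatrix h (Set.rangeFactorization r σ) i * ·) h1.symm).trans ?_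
    rw [Finset.mul_sum]
    refine Eq.trans (Finset.sum_congr rfl fun ρ hρ => ?_) h1
    rw [← mul_assoc, inducedMatrix_mul h hW, if_pos (Finset.mem_filter.mp hρ).2]
  · rw [← h1, IsSelfAdjoint, star_sum]
    exact Finset.sum_congr rfl fun ρ _ => by rw [star_mul, star_star]

/-- Multiplying the row sum $1=\sum_\tau W_{\sigma\tau}$ by $q^{r(\sigma)}_i$ keeps exactly the
terms with $r(\tau)=i$. -/
theorem inducedMatrix_eq_sum (hsum : ∀ σ, ∑ τ, W σ τ = 1) (hW : W ∈ unitary (Matrix E E A)) (σ : E) (i : Set.range r) :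
    inducedMatrix h (Set.rangeFactorization r σ) i = ∑ τ with r τ = i, W σ τ := by
  rw [← mul_one (inducedMatrix h _ i), ← hsum σ, Finset.mul_sum, Finset.sum_filter]
  exact Finset.sum_congr rfl fun τ _ => inducedMatrix_mul h hW σ τ i

/-- A unitary that fixes $\xi_0\otimes1$ has an adjoint that fixes it too. -/
theorem sum_col_of_unitary (hsum : ∀ σ, ∑ τ, W σ τ = 1) (hW : W ∈ unitary (Matrix E E A)) (τ : E) : ∑ σ, W σ τ = 1 := by
  have h1 : ∑ σ, star (W σ τ) = 1 := by
    calc ∑ σ, star (W σ τ) = ∑ σ, ∑ ρ, star (W σ τ) * W σ ρ := by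
          simp only [← Finset.mul_sum, hsum, mul_one]
      _ = ∑ ρ, (star W * W) τ ρ := by
          rw [Finset.sum_comm]; rfl
      _ = 1 := by
          rw [Unitary.star_mul_self_of_mem hW]
          simp [Matrix.one_apply]
  rw [← star_inj, star_sum, h1, star_one]

theorem sum_inducedMatrix_row (hsum : ∀ σ, ∑ τ, W σ τ = 1) (hW : W ∈ unitary (Matrix E E A)) (k : Set.range r) :
    ∑ i, inducedMatrix h k i = 1 := by
  obtain ⟨_, σ, rfl⟩ := k
  rw [← hsum σ, ← Finset.sum_fiberwise (g := Set.rangeFactorization r)]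
  refine Finset.sum_congr rfl fun i _ => ?_
  refine (inducedMatrix_eq_sum h hsum hW σ i).trans (Finset.sum_congr ?_ fun _ _ => rfl)
  ext τ
  simp [Subtype.ext_iff]

/-- With $N_k$ the size of the fibre of $r$ over $k$, the weighted column sum is $\sum_\sigma
q^{r(\sigma)}_j=\sum_{r(\tau)=j}\sum_\sigma W_{\sigma\tau}=N_j$, and `sum_col_eq_one` removes the
weights. The fibres are nonempty because $k$ runs over the range of $r$. -/
theorem sum_inducedMatrix_col (hsum : ∀ σ, ∑ τ, W σ τ = 1) (hW : W ∈ unitary (Matrix E E A)) (i : Set.range r) :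
    ∑ k, inducedMatrix h k i = 1 := by
  refine sum_col_eq_one (isStarProjection_inducedMatrix h hW) (sum_inducedMatrix_row h hsum hW)
    (N := fun k => ((Finset.univ.filter fun τ => Set.rangeFactorization r τ = k).card : ℝ))
    (fun k => ?_) (fun j => ?_) i
  · obtain ⟨_, σ, rfl⟩ := k
    rw [Nat.cast_pos, Finset.card_pos]
    exact ⟨σ, Finset.mem_filter.mpr ⟨Finset.mem_univ σ, rfl⟩⟩
  · calc _ = ∑ k, ∑ σ with Set.rangeFactorization r σ = k,
          inducedMatrix h (Set.rangeFactorization r σ) j := by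
          refine Finset.sum_congr rfl fun k _ => ?_
          rw [Finset.sum_congr rfl fun σ hσ => by rw [(Finset.mem_filter.mp hσ).2],
            Finset.sum_const, Nat.cast_smul_eq_nsmul]
      _ = ∑ σ, inducedMatrix h (Set.rangeFactorization r σ) j :=
          Finset.sum_fiberwise (g := Set.rangeFactorization r) ..
      _ = ∑ τ with r τ = j, ∑ σ, W σ τ := by
          rw [Finset.sum_comm]
          exact Finset.sum_congr rfl fun σ _ => inducedMatrix_eq_sum h hsum hW σ j
      _ = _ := by
          simp only [sum_col_of_unitary hsum hW, Finset.sum_const]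
          rw [Nat.cast_smul_eq_nsmul]
          simp [Subtype.ext_iff]

/-- Multiply $\sum_\sigma W_{\sigma\tau}W_{\sigma\tau}^*=1$, which is unitarity of the entrywise
adjoint of $W$, by $q^k_{r(\tau)}$. Since $W_{\sigma\tau}=q^{r(\sigma)}_{r(\tau)}W_{\sigma\tau}$ and
the projections in one column are orthogonal, only the terms with $r(\sigma)=k$ survive. -/
theorem sum_fiber_mul_star_col (hsum : ∀ σ, ∑ τ, W σ τ = 1) (hW : W ∈ unitary (Matrix E E A))
    (hW' : W.map star ∈ unitary (Matrix E E A)) (k : Set.range r) (τ : E) :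
    ∑ σ with r σ = k, W σ τ * star (W σ τ) =
      inducedMatrix h k (Set.rangeFactorization r τ) := by
  have h1 : ∑ σ, W σ τ * star (W σ τ) = 1 := by
    have h2 : (star (W.map star) * W.map star) τ τ = (1 : Matrix E E A) τ τ := by
      rw [Unitary.star_mul_self_of_mem hW']
    rw [Matrix.one_apply_eq, Matrix.mul_apply] at h2
    simpa only [Matrix.star_apply, Matrix.map_apply, star_star] using h2
  rw [← mul_one (inducedMatrix h k _), ← h1, Finset.mul_sum, Finset.sum_filter]
  refine Finset.sum_congr rfl fun σ _ => ?_
  have h3 := (inducedMatrix_mul h hW σ τ (Set.rangeFactorization r τ)).trans (if_pos rfl)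
  rw [← mul_assoc]
  split_ifs with hk
  · obtain rfl : Set.rangeFactorization r σ = k := Subtype.ext hk
    rw [h3]
  · rw [← h3, ← mul_assoc, IsStarProjection.mul_eq_zero_of_sum_eq_one
      (q := fun k => inducedMatrix h k (Set.rangeFactorization r τ))
      (fun k => isStarProjection_inducedMatrix h hW _ _) (sum_inducedMatrix_col h hsum hW _)
      (fun hk' => hk (congrArg Subtype.val hk').symm), zero_mul, zero_mul]

end InducedMatrix

/-! ### The matrix $q$ over all vertices, glued from its source and target blocks -/

namespace IsBanicaCoaction

variable {V E A : Type u} [Fintype V] [DecidableEq V] [Fintype E] [DecidableEq E] [CStarAlgebra A]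
  {Q : CompactQuantumGroup A} {Γ : Multigraph V E} {β : (E → ℂ) →ₗ[ℂ] (E → A)}
  (h : IsBanicaCoaction Q Γ β)

theorem sum_row (h : IsBanicaCoaction Q Γ β) (σ : E) : ∑ τ, corepMatrix β σ τ = 1 := by
  have h1 := congrFun h.fixes σ
  rw [show (fun _ => 1 : E → ℂ) = ∑ τ, Pi.single τ 1 from
    (Finset.univ_sum_single fun _ => (1 : ℂ)).symm, map_sum, Finset.sum_apply] at h1
  exact h1

theorem sum_row_star (h : IsBanicaCoaction Q Γ β) (σ : E) : ∑ τ, (corepMatrix β).map star σ τ = 1 := by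
  simp only [Matrix.map_apply, ← star_sum, h.sum_row, star_one]

theorem vertexMatrix_source {i : V} (hi : i ∈ Set.range Γ.source) {k : V}
    (hk : k ∈ Set.range Γ.source) :
    inducedVertexMatrix h k i = inducedMatrix h.source ⟨k, hk⟩ ⟨i, hi⟩ := by
  rw [inducedVertexMatrix, Matrix.of_apply, inducedVertexMap, if_pos hi]
  exact Subtype.val_injective.extend_apply _ _ (⟨k, hk⟩ : Set.range Γ.source)

theorem vertexMatrix_eq_zero_of_source {i : V} (hi : i ∈ Set.range Γ.source) {k : V}
    (hk : k ∉ Set.range Γ.source) : inducedVertexMatrix h k i = 0 := by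
  rw [inducedVertexMatrix, Matrix.of_apply, inducedVertexMap, if_pos hi]
  exact Function.extend_apply' _ _ _ fun ⟨w, hw⟩ => hk (hw ▸ w.2)

theorem single_support {i : V} (hs : i ∈ Set.range Γ.source) (ht : i ∈ Set.range Γ.target) (v : V)
    (hv : v ∉ Set.range Γ.source ∩ Set.range Γ.target) : (Pi.single i 1 : V → ℂ) v = 0 :=
  Pi.single_eq_of_ne (by rintro rfl; exact hv ⟨hs, ht⟩) _

/-- The definition of $\alpha(\chi_i)$ gives precedence to $\alpha_s$, so for $i\in V^s\cap V^t$
condition 3 is needed: the two maps agree at $k\in V^s\cap V^t$ and $\alpha_t(\chi_i)$ vanishes at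
$k\in V^t\setminus V^s$. -/
theorem vertexMatrix_target {i : V} (hi : i ∈ Set.range Γ.target) {k : V}
    (hk : k ∈ Set.range Γ.target) :
    inducedVertexMatrix h k i = inducedMatrix h.target ⟨k, hk⟩ ⟨i, hi⟩ := by
  by_cases hi' : i ∈ Set.range Γ.source
  · by_cases hk' : k ∈ Set.range Γ.source
    · rw [h.vertexMatrix_source hi' hk']
      exact h.agree (Pi.single i 1) (single_support hi' hi) k hk' hk
    · rw [h.vertexMatrix_eq_zero_of_source hi' hk']
      exact (h.target_preserves _ (fun v hv => single_support hi' hi v fun hv' => hv hv'.1)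
        ⟨k, hk⟩ hk').symm
  · rw [inducedVertexMatrix, Matrix.of_apply, inducedVertexMap, if_neg hi']
    exact Subtype.val_injective.extend_apply _ _ (⟨k, hk⟩ : Set.range Γ.target)

theorem vertexMatrix_eq_zero_of_target {i : V} (hi : i ∈ Set.range Γ.target) {k : V}
    (hk : k ∉ Set.range Γ.target) : inducedVertexMatrix h k i = 0 := by
  by_cases hi' : i ∈ Set.range Γ.source
  · by_cases hk' : k ∈ Set.range Γ.source
    · rw [h.vertexMatrix_source hi' hk']
      exact h.source_preserves _ (fun v hv => single_support hi' hi v fun hv' => hv hv'.2)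
        ⟨k, hk'⟩ hk
    · exact h.vertexMatrix_eq_zero_of_source hi' hk'
  · rw [inducedVertexMatrix, Matrix.of_apply, inducedVertexMap, if_neg hi']
    exact Function.extend_apply' _ _ _ fun ⟨w, hw⟩ => hk (hw ▸ w.2)

theorem isStarProjection_vertexMatrix
    (hΓ : ∀ v : V, v ∈ Set.range Γ.source ∨ v ∈ Set.range Γ.target) (k i : V) :
    IsStarProjection (inducedVertexMatrix h k i) := by
  rcases hΓ i with hi | hi
  · by_cases hk : k ∈ Set.range Γ.source
    · rw [h.vertexMatrix_source hi hk]
      exact isStarProjection_inducedMatrix h.source h.mem_unitary _ _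
    · rw [h.vertexMatrix_eq_zero_of_source hi hk]
      exact .zero A
  · by_cases hk : k ∈ Set.range Γ.target
    · rw [h.vertexMatrix_target hi hk]
      exact isStarProjection_inducedMatrix h.target h.map_star_mem_unitary _ _
    · rw [h.vertexMatrix_eq_zero_of_target hi hk]
      exact .zero A

theorem sum_mul_star_fiber {i : V} (hi : i ∈ Set.range Γ.source) (σ ρ : E) :
    ∑ τ with Γ.source τ = i, corepMatrix β σ τ * star (corepMatrix β ρ τ) =
      if σ = ρ then inducedVertexMatrix h (Γ.source σ) i else 0 := by
  rw [h.vertexMatrix_source hi ⟨σ, rfl⟩]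
  exact sum_fiber_mul_star h.source σ ρ ⟨i, hi⟩

/-- The column identity for $W=\overline U$, where $W_{\sigma\tau}W_{\sigma\tau}^*$ becomes
$u^{\sigma*}_\tau u^\sigma_\tau$. If $k$ is not a target, both sides vanish. -/
theorem sum_star_mul_fiber (k : V) (τ : E) :
    ∑ σ with Γ.target σ = k, star (corepMatrix β σ τ) * corepMatrix β σ τ =
      inducedVertexMatrix h k (Γ.target τ) := by
  by_cases hk : k ∈ Set.range Γ.target
  · rw [h.vertexMatrix_target ⟨τ, rfl⟩ hk]
    have h1 := sum_fiber_mul_star_col h.target h.sum_row_star h.map_star_mem_unitary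
      -- The entrywise adjoint of $\overline U$ is $U$ again, so unitarity of both matrices is used
      -- here.
      (by simpa [Matrix.map_map, Function.comp_def] using h.mem_unitary) ⟨k, hk⟩ τ
    simp only [Matrix.map_apply, star_star] at h1
    exact h1
  · rw [h.vertexMatrix_eq_zero_of_target ⟨τ, rfl⟩ hk]
    exact Finset.sum_eq_zero fun σ hσ => (hk ⟨σ, (Finset.mem_filter.mp hσ).2⟩).elim

open Classical in
theorem sum_source_row {k : V} (hk : k ∈ Set.range Γ.source) :
    ∑ i with i ∈ Set.range Γ.source, inducedVertexMatrix h k i = 1 := by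
  rw [← sum_inducedMatrix_row h.source h.sum_row h.mem_unitary ⟨k, hk⟩]
  exact (Finset.sum_subtype (p := (· ∈ Set.range Γ.source)) _ (by simp) _).trans
    (Finset.sum_congr rfl fun i _ => h.vertexMatrix_source i.2 hk)

open Classical in
theorem sum_target_row {k : V} (hk : k ∈ Set.range Γ.target) :
    ∑ i with i ∈ Set.range Γ.target, inducedVertexMatrix h k i = 1 := by
  rw [← sum_inducedMatrix_row h.target h.sum_row_star h.map_star_mem_unitary ⟨k, hk⟩]
  exact (Finset.sum_subtype (p := (· ∈ Set.range Γ.target)) _ (by simp) _).trans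
    (Finset.sum_congr rfl fun i _ => h.vertexMatrix_target i.2 hk)

open Classical in
theorem sum_target_col {i : V} (hi : i ∈ Set.range Γ.target) :
    ∑ k with k ∈ Set.range Γ.target, inducedVertexMatrix h k i = 1 := by
  rw [← sum_inducedMatrix_col h.target h.sum_row_star h.map_star_mem_unitary ⟨i, hi⟩]
  exact (Finset.sum_subtype (p := (· ∈ Set.range Γ.target)) _ (by simp) _).trans
    (Finset.sum_congr rfl fun k _ => h.vertexMatrix_target hi k.2)

/-- The induced co-action separates the vertices that are not sources from the sources. -/
theorem vertexMatrix_eq_zero {k i : V} (hk : k ∈ Set.range Γ.source)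
    (hi : i ∉ Set.range Γ.source) (hit : i ∈ Set.range Γ.target) :
    inducedVertexMatrix h k i = 0 := by
  classical
  -- Only $k\in V^s\cap V^t$ needs work. There the block of $q$ with rows in $V^s\cap V^t$ and
  -- columns in $V^t$ is summed in two ways.
  by_cases hkt : k ∈ Set.range Γ.target
  swap
  · exact h.vertexMatrix_eq_zero_of_target hit hkt
  let T : Finset V := Finset.univ.filter (· ∈ Set.range Γ.target)
  have mem_T : ∀ {v}, v ∈ T ↔ v ∈ Set.range Γ.target := by simp [T]
  have h1 : ∑ k ∈ T with k ∈ Set.range Γ.source, ∑ i ∈ T, inducedVertexMatrix h k i =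
      ∑ k ∈ T with k ∈ Set.range Γ.source, (1 : A) :=
    Finset.sum_congr rfl fun k hk => h.sum_target_row (mem_T.mp (Finset.mem_filter.mp hk).1)
  -- The columns in $V^s\cap V^t$ alone already contribute $|V^s\cap V^t|\cdot1$: such a column sums
  -- to $1$ over $V^t$ and vanishes at rows outside $V^s$. The row sums in `h1` give the same total
  -- for all columns in $V^t$, so nothing is left for the columns in $V^t\setminus V^s$.
  have h2 : ∑ k ∈ T with k ∈ Set.range Γ.source, ∑ i ∈ T with i ∈ Set.range Γ.source,
      inducedVertexMatrix h k i = ∑ k ∈ T with k ∈ Set.range Γ.source, (1 : A) := by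
    refine Finset.sum_comm.trans (Finset.sum_congr rfl fun i hi => ?_)
    have hi' := Finset.mem_filter.mp hi
    rw [← h.sum_target_col (mem_T.mp hi'.1)]
    exact Finset.sum_filter_of_ne fun k _ hk =>
      by_contra fun hk' => hk (h.vertexMatrix_eq_zero_of_source hi'.2 hk')
  have h3 : ∑ x ∈ (T.filter (· ∈ Set.range Γ.source)) ×ˢ (T.filter (· ∉ Set.range Γ.source)),
      inducedVertexMatrix h x.1 x.2 = 0 := by
    rw [Finset.sum_product]
    simp only [← Finset.sum_filter_add_sum_filter_not T (· ∈ Set.range Γ.source)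
      (inducedVertexMatrix h _), Finset.sum_add_distrib] at h1
    rw [h2] at h1
    exact add_eq_left.mp h1
  refine IsStarProjection.eq_zero_of_sum_eq_zero (i := (k, i)) (fun x hx => ?_) h3
    (by simp only [Finset.mem_product, Finset.mem_filter, mem_T]; exact ⟨⟨hkt, hk⟩, hit, hi⟩)
  obtain ⟨hx1, hx2⟩ := Finset.mem_product.mp hx
  rw [h.vertexMatrix_target (mem_T.mp (Finset.mem_filter.mp hx2).1)
    (mem_T.mp (Finset.mem_filter.mp hx1).1)]
  exact isStarProjection_inducedMatrix h.target h.map_star_mem_unitary _ _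

/-- One block already gives the row sum $1$; the entries outside it vanish. For $k\notin V^s$ this
is immediate, since $\alpha_s$ has values supported on $V^s$; for $k\in V^s$ it is the counting
result `vertexMatrix_eq_zero`. -/
theorem sum_vertexMatrix_row
    (hΓ : ∀ v : V, v ∈ Set.range Γ.source ∨ v ∈ Set.range Γ.target) (k : V) :
    ∑ i, inducedVertexMatrix h k i = 1 := by
  classical
  by_cases hk : k ∈ Set.range Γ.source
  · rw [← h.sum_source_row hk]
    refine (Finset.sum_filter_of_ne fun i _ hi => by_contra fun hi' => hi ?_).symm
    exact h.vertexMatrix_eq_zero hk hi' ((hΓ i).resolve_left hi')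
  · rw [← h.sum_target_row ((hΓ k).resolve_left hk)]
    refine (Finset.sum_filter_of_ne fun i _ hi => by_contra fun hi' => hi ?_).symm
    exact h.vertexMatrix_eq_zero_of_source ((hΓ i).resolve_right hi') hk

end IsBanicaCoaction

/-! ### Elementary tensors and the density condition for a co-action -/

namespace MinTensor

variable {A B : Type u} [CStarAlgebra A] [CStarAlgebra B]

theorem tmul_mul_tmul (a a' : A) (b b' : B) :
    tmul a b * tmul a' b' = tmul (a * a') (b * b') := by
  rw [tmul, tmul, ← map_mul, Algebra.TensorProduct.tmul_mul_tmul, tmul]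

theorem star_tmul (a : A) (b : B) : star (tmul a b) = tmul (star a) (star b) := by
  rw [tmul, ← map_star, TensorProduct.star_tmul, tmul]

theorem one_tmul_one : tmul (1 : A) (1 : B) = 1 := map_one ofAlg

theorem tmul_sum {ι : Type*} (s : Finset ι) (a : A) (b : ι → B) :
    tmul a (∑ i ∈ s, b i) = ∑ i ∈ s, tmul a (b i) := by
  rw [tmul, TensorProduct.tmul_sum, map_sum]; rfl

theorem sum_tmul {ι : Type*} (s : Finset ι) (a : ι → A) (b : B) :
    tmul (∑ i ∈ s, a i) b = ∑ i ∈ s, tmul (a i) b := by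
  rw [tmul, TensorProduct.sum_tmul, map_sum]; rfl

theorem tmul_zero (a : A) : tmul a (0 : B) = 0 := by
  rw [tmul, TensorProduct.tmul_zero, map_zero]

theorem zero_tmul (b : B) : tmul (0 : A) b = 0 := by
  rw [tmul, TensorProduct.zero_tmul, map_zero]

theorem add_tmul (a a' : A) (b : B) : tmul (a + a') b = tmul a b + tmul a' b := by
  rw [tmul, TensorProduct.add_tmul, map_add]; rfl

theorem smul_tmul (c : ℂ) (a : A) (b : B) : tmul (c • a) b = c • tmul a b := by
  rw [tmul, ← TensorProduct.smul_tmul', map_smul]; rfl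

variable (γ : B →⋆ₐ[ℂ] MinTensor B A)

/-- The closed linear span of `γ(B)(1 ⊗ A)`. -/
def coactionSpan : Submodule ℂ (MinTensor B A) :=
  (Submodule.span ℂ {x : MinTensor B A | ∃ (b : B) (a : A), x = γ b * tmul 1 a}).topologicalClosure

theorem isClosed_coactionSpan : IsClosed (coactionSpan γ : Set (MinTensor B A)) :=
  Submodule.isClosed_topologicalClosure _

variable {γ}

theorem mul_mem_coactionSpan (b : B) (a : A) : γ b * tmul 1 a ∈ coactionSpan γ :=
  Submodule.le_topologicalClosure _ (Submodule.subset_span ⟨b, a, rfl⟩)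

/-- The preimage of a closed subspace under a continuous linear map is a closed subspace, so
invariance need only be tested on $\gamma(b)(1\otimes a)$. -/
theorem coactionSpan_induction {f : MinTensor B A →ₗ[ℂ] MinTensor B A} (hf : Continuous f)
    (h : ∀ b a, f (γ b * tmul 1 a) ∈ coactionSpan γ) {x : MinTensor B A}
    (hx : x ∈ coactionSpan γ) : f x ∈ coactionSpan γ := by
  have h1 : coactionSpan γ ≤ (coactionSpan γ).comap f := by
    refine Submodule.topologicalClosure_minimal _ (Submodule.span_le.mpr ?_)
      ((isClosed_coactionSpan γ).preimage hf)
    rintro _ ⟨b, a, rfl⟩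
    exact h b a
  exact h1 hx

theorem left_mul_mem_coactionSpan (b : B) {x : MinTensor B A} (hx : x ∈ coactionSpan γ) :
    γ b * x ∈ coactionSpan γ := by
  refine coactionSpan_induction (f := LinearMap.mulLeft ℂ (γ b))
    (continuous_const.mul continuous_id) (fun b' a => ?_) hx
  rw [LinearMap.mulLeft_apply, ← mul_assoc, ← map_mul]
  exact mul_mem_coactionSpan _ _

theorem right_mul_mem_coactionSpan (a : A) {x : MinTensor B A} (hx : x ∈ coactionSpan γ) :
    x * tmul 1 a ∈ coactionSpan γ := by
  refine coactionSpan_induction (f := LinearMap.mulRight ℂ (tmul 1 a))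
    (continuous_id.mul continuous_const) (fun b a' => ?_) hx
  rw [LinearMap.mulRight_apply, mul_assoc, tmul_mul_tmul, one_mul]
  exact mul_mem_coactionSpan _ _

variable (γ) in
/-- The subalgebra of all `b` for which `b ⊗ 1` is in the closed linear span of `γ(B)(1 ⊗ A)`. -/
def coactionSubalgebra : Subalgebra ℂ B where
  carrier := {b | tmul b 1 ∈ coactionSpan γ}
  mul_mem' {x y} hx hy := by
    change tmul (x * y) 1 ∈ coactionSpan γ
    rw [← mul_one (1 : A), ← tmul_mul_tmul]
    -- Replace $x\otimes1$ by $\gamma(b)(1\otimes a)$. As $1\otimes a$ commutes with $y\otimes1$,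
    -- the product is $\gamma(b)(y\otimes1)(1\otimes a)$, and the closed span is stable under
    -- $\gamma(B)$ on the left and $1\otimes\mathcal A$ on the right.
    refine coactionSpan_induction (f := LinearMap.mulRight ℂ (tmul y 1))
      (continuous_id.mul continuous_const) (fun b a => ?_) hx
    rw [LinearMap.mulRight_apply, mul_assoc, tmul_mul_tmul, one_mul, mul_one, ← mul_one y,
      ← one_mul a, ← tmul_mul_tmul]
    exact left_mul_mem_coactionSpan b (right_mul_mem_coactionSpan a hy)
  add_mem' {x y} hx hy := by
    change tmul (x + y) 1 ∈ coactionSpan γ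
    rw [add_tmul]
    exact add_mem hx hy
  algebraMap_mem' c := by
    change tmul (algebraMap ℂ B c) 1 ∈ coactionSpan γ
    rw [Algebra.algebraMap_eq_smul_one, smul_tmul]
    refine Submodule.smul_mem _ _ ?_
    simpa using mul_mem_coactionSpan (γ := γ) 1 1

theorem mem_coactionSubalgebra {b : B} : b ∈ coactionSubalgebra γ ↔ tmul b 1 ∈ coactionSpan γ :=
  Iff.rfl

theorem isClosed_coactionSubalgebra : IsClosed (coactionSubalgebra γ : Set B) :=
  (isClosed_coactionSpan γ).preimage (continuous_tmul_left 1)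

/-- The span of `γ(B)(1 ⊗ A)` is dense if its closure contains `B ⊗ 1`. -/
theorem dense_span_of_coactionSubalgebra (h : ∀ b, b ∈ coactionSubalgebra γ) :
    Dense (Submodule.span ℂ {x : MinTensor B A |
      ∃ (b : B) (a : A), x = γ b * tmul 1 a} : Set (MinTensor B A)) := by
  intro x
  change x ∈ coactionSpan γ
  refine denseRange_ofAlg.induction_on (p := fun x => x ∈ coactionSpan γ) x
    (isClosed_coactionSpan γ) fun y => ?_
  induction y using TensorProduct.induction_on with
  | zero => rw [map_zero]; exact zero_mem _
  | add s t hs ht => rw [map_add]; exact add_mem hs ht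
  | tmul b a =>
    have h1 := right_mul_mem_coactionSpan a (mem_coactionSubalgebra.mp (h b))
    rwa [tmul_mul_tmul, mul_one, one_mul] at h1

end MinTensor

/-! ### Orthogonal ranges and generation by edges in graph C*-algebras -/

namespace Multigraph

variable {V E : Type u} [Fintype V] [DecidableEq V] [Fintype E] [DecidableEq E]
  {Γ : Multigraph V E}

theorem IsFamily.isStarProjection_mul_star {D : Type*} [CStarAlgebra D] {P : V → D} {S : E → D}
    (h : Γ.IsFamily P S) (τ : E) : IsStarProjection (S τ * star (S τ)) where
  isIdempotentElem := by
    rw [IsIdempotentElem, ← mul_assoc, h.partialIsometry]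
  isSelfAdjoint := .mul_star_self _

/-- The ranges of the partial isometries of distinct edges are orthogonal. -/
theorem IsFamily.star_mul_eq_zero {D : Type*} [CStarAlgebra D] {P : V → D} {S : E → D}
    (h : Γ.IsFamily P S) {σ τ : E} (hστ : σ ≠ τ) : star (S σ) * S τ = 0 := by
  classical
  -- The range projections of the edges add up only to $\sum_{i\in V^s}P_i$; adjoining the $P_v$
  -- with $v\notin V^s$ completes them to a family of projections with sum $1$, which is therefore
  -- orthogonal.
  let f : E ⊕ {v // v ∉ Set.range Γ.source} → D :=
    Sum.elim (fun τ => S τ * star (S τ)) fun v => P v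
  have hf : ∀ x, IsStarProjection (f x) := by
    rintro (τ | v)
    · exact h.isStarProjection_mul_star τ
    · exact h.isStarProjection v
  have hsum : ∑ x, f x = 1 := by
    have h1 : ∑ τ, S τ * star (S τ) = ∑ v with v ∈ Set.range Γ.source, P v := by
      rw [← Finset.sum_fiberwise (g := Γ.source), Finset.sum_filter]
      refine Finset.sum_congr rfl fun v _ => ?_
      split_ifs with hv
      · exact h.sum_mul_star v hv
      · exact Finset.sum_eq_zero fun τ hτ => (hv ⟨τ, (Finset.mem_filter.mp hτ).2⟩).elim
    rw [Fintype.sum_sum_type, ← h.sum_eq_one,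
      ← Finset.sum_filter_add_sum_filter_not Finset.univ (· ∈ Set.range Γ.source) P]
    congr 1
    exact (Finset.sum_subtype (p := (· ∉ Set.range Γ.source)) _ (by simp) P).symm
  have h2 := IsStarProjection.mul_eq_zero_of_sum_eq_one hf hsum
    (i := Sum.inl σ) (j := Sum.inl τ) (by simpa using hστ)
  change S σ * star (S σ) * (S τ * star (S τ)) = 0 at h2
  -- Inserting $S=SS^*S$ on both sides exposes the product of the two range projections in the
  -- middle.
  have h3 : star (S σ) * S τ =
      star (S σ * star (S σ) * S σ) * (S τ * star (S τ) * S τ) := by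
    rw [h.partialIsometry, h.partialIsometry]
  rw [h3, star_mul, star_mul, star_star, mul_assoc, ← mul_assoc (S σ * _), h2, zero_mul, mul_zero]

namespace GraphCStarAlgebra

/-- A closed subalgebra that contains the partial isometries of the edges and their adjoints is the
whole graph C*-algebra, if there are no isolated vertices. -/
theorem mem_of_isClosed (hΓ : ∀ v : V, v ∈ Set.range Γ.source ∨ v ∈ Set.range Γ.target)
    {G : Subalgebra ℂ Γ.GraphCStarAlgebra} (hG : IsClosed (G : Set Γ.GraphCStarAlgebra))
    (hs : ∀ τ, s Γ τ ∈ G) (hs' : ∀ τ, star (s Γ τ) ∈ G) (x : Γ.GraphCStarAlgebra) : x ∈ G := by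
  have hF := isFamily Γ
  -- The vertex projections need not be assumed in $G$: a source projection is a sum of $s_\tau
  -- s_\tau^*$ and a target projection is some $s_\tau^*s_\tau$.
  have hp : ∀ i, p Γ i ∈ G := fun i => by
    rcases hΓ i with hi | ⟨τ, rfl⟩
    · rw [← hF.sum_mul_star i hi]
      exact sum_mem fun τ _ => mul_mem (hs τ) (hs' τ)
    · rw [← hF.star_mul_self τ]
      exact mul_mem (hs' τ) (hs τ)
  have hgen : ∀ y : (V ⊕ E) × Bool,
      Γ.graphNorm.coeHom (FreeStarAlgebra.word (FreeMonoid.of y)) ∈ G := by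
    rintro ⟨y, b⟩
    cases b with
    | false =>
      rcases y with i | τ
      · exact hp i
      · exact hs τ
    | true =>
      rw [← FreeStarAlgebra.star_gen, map_star]
      rcases y with i | τ
      · change star (p Γ i) ∈ G
        rw [(hF.isStarProjection i).isSelfAdjoint.star_eq]
        exact hp i
      · exact hs' τ
  refine Γ.graphNorm.denseRange_coeHom.induction_on (p := fun x => x ∈ G) x hG fun y => ?_
  refine FreeStarAlgebra.induction (p := fun y => Γ.graphNorm.coeHom y ∈ G) (fun w => ?_)
    (fun x y hx hy => ?_) (fun c x hx => ?_) y
  · induction w using FreeMonoid.inductionOn' with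
    | one => rw [FreeStarAlgebra.word_one, map_one]; exact one_mem G
    | of_mul y w hw =>
      rw [FreeStarAlgebra.word_mul, map_mul]
      exact mul_mem (hgen y) hw
  · rw [map_add]; exact add_mem hx hy
  · rw [map_smul]; exact G.smul_mem hx c

/-- The equalizer of two *-homomorphisms is a closed subalgebra, so `mem_of_isClosed` applies to it.
This lets co-associativity be checked on edges alone, without any formula for $\Delta(q^k_i)$. -/
theorem hom_ext (hΓ : ∀ v : V, v ∈ Set.range Γ.source ∨ v ∈ Set.range Γ.target) {D : Type*}
    [CStarAlgebra D] {φ ψ : Γ.GraphCStarAlgebra →⋆ₐ[ℂ] D} (h : ∀ τ, φ (s Γ τ) = ψ (s Γ τ)) :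
    φ = ψ := by
  ext x
  refine mem_of_isClosed hΓ (G := AlgHom.equalizer φ.toAlgHom ψ.toAlgHom)
    (isClosed_eq (map_continuous φ) (map_continuous ψ)) h (fun τ => ?_) x
  change φ (star _) = ψ (star _)
  rw [map_star, map_star, h]

end GraphCStarAlgebra
end Multigraph

/-! ### The co-action on the graph C*-algebra -/

section Coaction

open MinTensor Multigraph GraphCStarAlgebra

variable {V E A : Type u} [Fintype V] [DecidableEq V] [Fintype E] [DecidableEq E] [CStarAlgebra A]
  {Q : CompactQuantumGroup A} {Γ : Multigraph V E} {β : (E → ℂ) →ₗ[ℂ] (E → A)}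

variable (Γ β) in
/-- The image `∑ σ, s_σ ⊗ u^σ_τ` of the partial isometry of an edge. -/
def coactionS (τ : E) : MinTensor Γ.GraphCStarAlgebra A :=
  ∑ σ, tmul (s Γ σ) (corepMatrix β σ τ)

namespace IsBanicaCoaction

variable (h : IsBanicaCoaction Q Γ β)

/-- The image `∑ k, p_k ⊗ q^k_i` of the projection of a vertex. -/
def coactionP (i : V) : MinTensor Γ.GraphCStarAlgebra A :=
  ∑ k, tmul (p Γ k) (inducedVertexMatrix h k i)

/-- Orthogonality of the $p_k$ removes the cross terms, which reduces relations among the $P_i$ to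
relations within single rows of $q$. -/
theorem coactionP_mul (i j : V) : h.coactionP i * h.coactionP j =
    ∑ k, tmul (p Γ k) (inducedVertexMatrix h k i * inducedVertexMatrix h k j) := by
  rw [coactionP, coactionP, Finset.sum_mul]
  refine Finset.sum_congr rfl fun k _ => ?_
  rw [Finset.mul_sum, Finset.sum_eq_single k (fun l _ hl => ?_) (by simp), tmul_mul_tmul,
    ((isFamily Γ).isStarProjection k).isIdempotentElem.eq]
  rw [tmul_mul_tmul, (isFamily Γ).mul_eq_zero k l hl.symm, zero_tmul]

/-- Orthogonality of the ranges of the $s_\sigma$ leaves $\sum_\sigma p_{t(\sigma)}\otimes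
u^{\sigma*}_\tau u^\sigma_\tau$; grouping by target and applying `sum_star_mul_fiber` gives the
claim. -/
theorem star_coactionS_mul (τ : E) :
    star (coactionS Γ β τ) * coactionS Γ β τ = h.coactionP (Γ.target τ) := by
  have h1 : star (coactionS Γ β τ) * coactionS Γ β τ = ∑ σ, tmul (p Γ (Γ.target σ))
      (star (corepMatrix β σ τ) * corepMatrix β σ τ) := by
    rw [coactionS, star_sum, Finset.sum_mul]
    refine Finset.sum_congr rfl fun σ _ => ?_
    rw [star_tmul, Finset.mul_sum, Finset.sum_eq_single σ (fun ρ _ hρ => ?_) (by simp),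
      tmul_mul_tmul, (isFamily Γ).star_mul_self]
    rw [tmul_mul_tmul, (isFamily Γ).star_mul_eq_zero hρ.symm, zero_tmul]
  rw [h1, coactionP, ← Finset.sum_fiberwise (g := Γ.target)]
  refine Finset.sum_congr rfl fun k _ => ?_
  rw [← h.sum_star_mul_fiber, tmul_sum]
  exact Finset.sum_congr rfl fun σ hσ => by rw [(Finset.mem_filter.mp hσ).2]

/-- Here the cross terms $s_\sigma s_\rho^*$ need not vanish in $C^*(\Gamma)$; it is the coefficient
in $\mathcal A$, by `sum_mul_star_fiber`, that is zero for $\sigma\ne\rho$. What remains is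
$\sum_\sigma s_\sigma s_\sigma^*\otimes q^{s(\sigma)}_i$, grouped by source. -/
theorem sum_coactionS_mul_star {i : V} (hi : i ∈ Set.range Γ.source) :
    ∑ τ with Γ.source τ = i, coactionS Γ β τ * star (coactionS Γ β τ) = h.coactionP i := by
  have h1 : ∑ τ with Γ.source τ = i, coactionS Γ β τ * star (coactionS Γ β τ) =
      ∑ σ, ∑ ρ, tmul (s Γ σ * star (s Γ ρ))
        (∑ τ with Γ.source τ = i, corepMatrix β σ τ * star (corepMatrix β ρ τ)) := by
    simp only [tmul_sum, coactionS, star_sum, Finset.sum_mul_sum, star_tmul, tmul_mul_tmul]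
    rw [Finset.sum_comm]
    exact Finset.sum_congr rfl fun σ _ => Finset.sum_comm
  simp only [h.sum_mul_star_fiber hi] at h1
  rw [h1, coactionP, ← Finset.sum_fiberwise (g := Γ.source)]
  refine Finset.sum_congr rfl fun k _ => ?_
  have h2 : ∀ σ, ∑ ρ, tmul (s Γ σ * star (s Γ ρ))
      (if σ = ρ then inducedVertexMatrix h (Γ.source σ) i else 0) =
      tmul (s Γ σ * star (s Γ σ)) (inducedVertexMatrix h (Γ.source σ) i) := fun σ => by
    rw [Finset.sum_eq_single σ (fun ρ _ hρ => ?_) (by simp), if_pos rfl]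
    rw [if_neg hρ.symm, tmul_zero]
  simp only [h2]
  by_cases hk : k ∈ Set.range Γ.source
  · rw [← (isFamily Γ).sum_mul_star k hk, sum_tmul]
    exact Finset.sum_congr rfl fun σ hσ => by rw [(Finset.mem_filter.mp hσ).2]
  · rw [h.vertexMatrix_eq_zero_of_source hi hk, tmul_zero]
    exact Finset.sum_eq_zero fun σ hσ => (hk ⟨σ, (Finset.mem_filter.mp hσ).2⟩).elim

theorem isFamily_coaction (hΓ : ∀ v : V, v ∈ Set.range Γ.source ∨ v ∈ Set.range Γ.target) :
    Γ.IsFamily h.coactionP (coactionS Γ β) := by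
  have hP : ∀ i, IsStarProjection (h.coactionP i) := fun i => by
    constructor
    · rw [IsIdempotentElem, coactionP_mul, coactionP]
      exact Finset.sum_congr rfl fun k _ => by
        rw [(h.isStarProjection_vertexMatrix hΓ k i).isIdempotentElem.eq]
    · rw [IsSelfAdjoint, coactionP, star_sum]
      exact Finset.sum_congr rfl fun k _ => by
        rw [star_tmul, (h.isStarProjection_vertexMatrix hΓ k i).isSelfAdjoint.star_eq,
          ((isFamily Γ).isStarProjection k).isSelfAdjoint.star_eq]
  refine ⟨hP, fun i j hij => ?_, ?_, fun τ => ?_, h.star_coactionS_mul,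
    fun i hi => h.sum_coactionS_mul_star hi⟩
  · rw [coactionP_mul]
    refine Finset.sum_eq_zero fun k _ => ?_
    rw [IsStarProjection.mul_eq_zero_of_sum_eq_one (h.isStarProjection_vertexMatrix hΓ k)
      (h.sum_vertexMatrix_row hΓ k) hij, tmul_zero]
  · simp only [coactionP]
    rw [Finset.sum_comm]
    simp only [← tmul_sum, h.sum_vertexMatrix_row hΓ, ← sum_tmul]
    rw [(isFamily Γ).sum_eq_one, one_tmul_one]
  -- $S_\tau$ is a partial isometry because $S_\tau^*S_\tau=P_{t(\tau)}$ is a projection.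
  · refine mul_star_mul_self_of_isStarProjection ?_
    rw [h.star_coactionS_mul]
    exact hP _

/-- A *-homomorphism on the graph C*-algebra that maps the partial isometries of the edges
according to a co-action on the graph is a co-action. -/
theorem isCoaction (h : IsBanicaCoaction Q Γ β)
    (hΓ : ∀ v : V, v ∈ Set.range Γ.source ∨ v ∈ Set.range Γ.target)
    {γ : Γ.GraphCStarAlgebra →⋆ₐ[ℂ] MinTensor Γ.GraphCStarAlgebra A}
    (hγ : ∀ τ, γ (s Γ τ) = coactionS Γ β τ) : IsCoaction Q γ where
  coassoc b := by
    have h1 : (assoc Γ.GraphCStarAlgebra A A).comp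
        ((map γ (StarAlgHom.id ℂ A)).comp γ) =
        (map (StarAlgHom.id ℂ Γ.GraphCStarAlgebra) Q.comul).comp γ := by
      -- On $s_\tau$ both sides are $\sum_{\sigma,\rho}s_\sigma\otimes u^\sigma_\rho\otimes
      -- u^\rho_\tau$, by the co-representation identity for $U$.
      refine hom_ext hΓ fun τ => ?_
      simp only [StarAlgHom.comp_apply, hγ, coactionS, map_sum, map_tmul, sum_tmul, assoc_tmul,
        StarAlgHom.coe_id, id_eq, h.corep, tmul_sum]
      exact Finset.sum_comm
    exact DFunLike.congr_fun h1 b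
  dense := by
    refine dense_span_of_coactionSubalgebra (mem_of_isClosed hΓ isClosed_coactionSubalgebra
      (fun ρ => ?_) fun ρ => ?_)
    -- The equation $\gamma(s_\tau)=\sum_\sigma s_\sigma\otimes u^\sigma_\tau$ is inverted with
    -- $UU^*=1$.
    · have h1 : tmul (s Γ ρ) (1 : A) =
          ∑ τ, γ (s Γ τ) * tmul 1 (star (corepMatrix β ρ τ)) := by
        simp only [hγ, coactionS, Finset.sum_mul, tmul_mul_tmul, mul_one]
        rw [Finset.sum_comm]
        have h2 : ∀ σ, ∑ τ, corepMatrix β σ τ * star (corepMatrix β ρ τ) =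
            (1 : Matrix E E A) σ ρ := fun σ => by
          rw [← Unitary.mul_star_self_of_mem h.mem_unitary]; rfl
        simp only [← tmul_sum, h2]
        rw [Finset.sum_eq_single ρ (fun σ _ hσ => ?_) (by simp), Matrix.one_apply_eq]
        rw [Matrix.one_apply_ne hσ, tmul_zero]
      rw [mem_coactionSubalgebra, h1]
      exact sum_mem fun τ _ => mul_mem_coactionSpan _ _
    -- The subalgebra is not known to be closed under adjoints, so $s_\rho^*$ is treated separately;
    -- here the inversion uses $\overline U\,\overline U^{\,*}=1$.
    · have h1 : tmul (star (s Γ ρ)) (1 : A) =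
          ∑ τ, γ (star (s Γ τ)) * tmul 1 (corepMatrix β ρ τ) := by
        simp only [map_star, hγ, coactionS, star_sum, star_tmul, Finset.sum_mul, tmul_mul_tmul,
          mul_one]
        rw [Finset.sum_comm]
        have h2 : ∀ σ, ∑ τ, star (corepMatrix β σ τ) * corepMatrix β ρ τ =
            (1 : Matrix E E A) σ ρ := fun σ => by
          rw [← Unitary.mul_star_self_of_mem h.map_star_mem_unitary, Matrix.mul_apply]
          simp only [Matrix.star_apply, Matrix.map_apply, star_star]
        simp only [← tmul_sum, h2]
        rw [Finset.sum_eq_single ρ (fun σ _ hσ => ?_) (by simp), Matrix.one_apply_eq]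
        rw [Matrix.one_apply_ne hσ, tmul_zero]
      rw [mem_coactionSubalgebra, h1]
      exact sum_mem fun τ _ => mul_mem_coactionSpan _ _

end IsBanicaCoaction
end Coaction

end

theorem mainTheorem11 {V E A : Type u} [Fintype V] [DecidableEq V] [Fintype E] [DecidableEq E]
    [CStarAlgebra A] (Q : CompactQuantumGroup A) (Γ : Multigraph V E)
    (hΓ : ∀ v : V, v ∈ Set.range Γ.source ∨ v ∈ Set.range Γ.target)
    (β : (E → ℂ) →ₗ[ℂ] (E → A)) (hβ : IsBanicaCoaction Q Γ β) :
    ∃ β' : Γ.GraphCStarAlgebra →⋆ₐ[ℂ] MinTensor Γ.GraphCStarAlgebra A,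
      IsCoaction Q β' ∧
      (∀ i : V, β' (Multigraph.GraphCStarAlgebra.p Γ i) =
        ∑ k : V, MinTensor.tmul (Multigraph.GraphCStarAlgebra.p Γ k)
          (inducedVertexMatrix hβ k i)) ∧
      (∀ τ : E, β' (Multigraph.GraphCStarAlgebra.s Γ τ) =
        ∑ σ : E, MinTensor.tmul (Multigraph.GraphCStarAlgebra.s Γ σ) (corepMatrix β σ τ)) :=
  ⟨Multigraph.GraphCStarAlgebra.lift (hβ.isFamily_coaction hΓ),
    hβ.isCoaction hΓ (Multigraph.GraphCStarAlgebra.lift_s _),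
    Multigraph.GraphCStarAlgebra.lift_p _, Multigraph.GraphCStarAlgebra.lift_s _⟩
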